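/- \textbf{Setting.} There are $M\ge 1$ categories with $K\ge 1$ arms each. The $r$-th pull of arm $k$ of category $m$ yields the reward $X_k^m(r)$; all these rewards are independent, and $X_k^m(r)-\mu_k^m$ is $1$-sub-Gaussian, i.e. $\mathbb{E}\,e^{\lambda (X_k^m(r)-\mu_k^m)}\le e^{\lambda^2/2}$ for all $\lambda\in\mathbb{R}$. Write $\mu^m=(\mu^m_1,\dots,\mu^m_K)$. Number the arms of category $1$ so that $\mu_1^1=\max_k\mu_k^1$. Assume \emph{strong dominance}: $\mu^1_k\ge\mu^m_l$ for all $m\ge 2$ and all $k,l$. Put $\Delta_{m,k}=\mu_1^1-\mu_k^m\ge 0$. If the arms $(C_1,A_1),\dots,(C_T,A_T)$ are pulled, the regret is $R_T=\sum_{t=1}^T\Delta_{C_t,A_t}$. Let $\Delta(K)$ be the simplex of $x\in\mathbb{R}^K_+$ with $\sum_k x_k=1$. \textbf{Algorithm.} $\textsc{CatSE}(\delta)$, $\delta\in(0,1)$, starts with all categories active. In its elimination phase it works in rounds; in a round every arm of every active category is pulled once, in any order. At the end of a round let $\widehat\mu^m$ be the vector of empirical means of the arms of an active category $m$, let $p$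 be the number of times that each of its arms has been pulled, let $\beta(p,\delta)=\sqrt{\tfrac2p\left(K\log 2+\log\tfrac1\delta\right)}$ and $$L_m^+=\max_{x\in\Delta(K)}\left(\langle x,\widehat\mu^m\rangle-\|x\|_2\,\beta(p,\delta)\right),\qquad L_m^-=\min_{y\in\Delta(K)}\left(\langle y,\widehat\mu^m\rangle+\|y\|_2\,\beta(p,\delta)\right).$$ An active category $m$ is eliminated if $L_n^+>L_m^-$ for some other active category $n$. (If this eliminates all active categories, then all $M$ categories become active again.) As soon as exactly one category $c$ remains at the end of a round, the algorithm pulls from then on an arm $k$ of $c$ that maximizes $\widehat\mu^c_k+\sqrt{2\log(1/\delta)/N_k^c}$, where $N_k^c$ is the number of pulls of that arm so far and $\widehat\mu_k^c$ its current empirical mean; ties are broken arbitrarily. \textbf{Theorem.} For $m\ge 2$ let $$D_m=\min_{(x,y)\in\Delta(K)^2}\left(\frac{\|x\|_2+\|y\|_2}{\langle x,\mu^1\rangle-\langle y,\mu^m\rangle}\right)^2\in[0,\infty],$$ where a pair with $\langle x,\mu^1\rangle=\langle y,\mu^m\rangle$ counts as $\infty$. For every $T\ge 0$, with probability at least $1-2\delta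 MKT$, however the pulls are ordered inside the rounds and ties are broken, the regret of $\textsc{CatSE}(\delta)$ satisfies $$R_T\le\sum_{\substack{1\le k\le K\\ \Delta_{1,k}>0}}\frac{8\log\frac1\delta}{\Delta_{1,k}}+\sum_{m=1}^M\sum_{k=1}^K\Delta_{m,k}+8\left(K\log 2+\log\tfrac1\delta\right)\left(\sum_{m=1}^M\sum_{k=1}^K\Delta_{m,k}\right)D,$$ with $D=\max_{m\ge 2}D_m$ ($D=0$ if $M=1$, and $0\cdot\infty=0$). In particular, if $M\ge 2$ and category $2$ strongly dominates the categories $3,\dots,M$ (that is, $\mu^2_k\ge\mu^m_l$ for all $m\ge 3$ and all $k,l$), then on the same event this holds with $D=D_2$, that is, with $$D=\min_{(x,y)\in\Delta(K)^2}\left(\frac{\|x\|_2+\|y\|_2}{\langle x,\mu^1\rangle-\langle y,\mu^2\rangle}\right)^2.$$ -/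

import Mathlib

open MeasureTheory ProbabilityTheory
open scoped ENNReal

noncomputable section

namespace CategorizedBandit

/-- A category with mean vector `u` strongly dominates one with mean vector `v`: each of its arms
has a mean at least as large as each arm of the other. -/
def StronglyDominates {K : ℕ} (u v : Fin K → ℝ) : Prop := ∀ k l, v l ≤ u k

/-- `Δ_{m,k} = μ_1^1 - μ_k^m`. Categories and arms are numbered from `0` here, so that `μ 0 0` is
the mean written `μ_1^1` on paper. -/
def gap {M K : ℕ} [NeZero M] [NeZero K] (μ : Fin M → Fin K → ℝ) (m : Fin M) (k : Fin K) : ℝ :=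
  μ 0 0 - μ m k

/-- The Euclidean norm of a vector of weights. -/
def norm2 {K : ℕ} (x : Fin K → ℝ) : ℝ := ‖WithLp.toLp 2 x‖

/-- `min` over pairs `(x, y)` of points of the simplex of
`((‖x‖₂ + ‖y‖₂) / (⟨x, u⟩ - ⟨y, v⟩)) ^ 2`, in `[0, ∞]`. The numerator is positive, and a pair with
`⟨x, u⟩ ≤ ⟨y, v⟩` contributes the value `∞`. -/
def separationCost {K : ℕ} (u v : Fin K → ℝ) : ℝ≥0∞ :=
  ⨅ x ∈ stdSimplex ℝ (Fin K), ⨅ y ∈ stdSimplex ℝ (Fin K),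
    (ENNReal.ofReal (norm2 x + norm2 y) / ENNReal.ofReal (x ⬝ᵥ u - y ⬝ᵥ v)) ^ 2

/-! ### The algorithm CatSE

The reward of the `r`-th pull (`r = 0, 1, …`) of arm `k` of category `m` is `X m k r`. -/

/-- `β(p, δ)`, for vectors of `K` means. -/
def radius (K : ℕ) (p : ℕ) (δ : ℝ) : ℝ :=
  Real.sqrt (2 / p * (K * Real.log 2 + Real.log (1 / δ)))

/-- The empirical mean of the first `n` rewards of an arm. -/
def empMean (x : ℕ → ℝ) (n : ℕ) : ℝ := (∑ r ∈ Finset.range n, x r) / n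

/-- `L⁺`: the maximum over the simplex of `⟨x, v⟩ - ‖x‖₂ β(p, δ)`. -/
def indexPlus {K : ℕ} (v : Fin K → ℝ) (p : ℕ) (δ : ℝ) : ℝ :=
  ⨆ x : stdSimplex ℝ (Fin K), ((x : Fin K → ℝ) ⬝ᵥ v - norm2 (x : Fin K → ℝ) * radius K p δ)

/-- `L⁻`: the minimum over the simplex of `⟨y, v⟩ + ‖y‖₂ β(p, δ)`. -/
def indexMinus {K : ℕ} (v : Fin K → ℝ) (p : ℕ) (δ : ℝ) : ℝ :=
  ⨅ y : stdSimplex ℝ (Fin K), ((y : Fin K → ℝ) ⬝ᵥ v + norm2 (y : Fin K → ℝ) * radius K p δ)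

/-- The state of the algorithm between two pulls: how often each arm has been pulled, the categories
that are not eliminated, and the arms still to be pulled in the current round of the elimination
phase. In the UCB phase one category is active and no arm is pending. -/
structure State (M K : ℕ) where
  pulls : Fin M → Fin K → ℕ
  active : Finset (Fin M)
  pending : Finset (Fin M × Fin K)

/-- All categories are active, and the first round pulls every arm once. -/
def initState (M K : ℕ) : State M K where
  pulls := fun _ _ => 0
  active := Finset.univ
  pending := Finset.univ

/-- The vector of empirical means of category `m`. -/
def empVec {M K : ℕ} (X : Fin M → Fin K → ℕ → ℝ) (pulls : Fin M → Fin K → ℕ) (m : Fin M) :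
    Fin K → ℝ :=
  fun k => empMean (X m k) (pulls m k)

open Classical in
/-- The test at the end of a round in which the arms of the categories in `A` were pulled: category
`m` is eliminated by category `n` if `L⁺` of `n` exceeds `L⁻` of `m`. At the end of a round all
arms of a category have been pulled equally often, so that `pulls m 0` is the number of rounds
behind the estimate for category `m`. -/
def passing {M K : ℕ} [NeZero K] (X : Fin M → Fin K → ℕ → ℝ) (δ : ℝ)
    (pulls : Fin M → Fin K → ℕ) (A : Finset (Fin M)) : Finset (Fin M) :=
  A.filter fun m => ∀ n ∈ A, n ≠ m →
    indexPlus (empVec X pulls n) (pulls n 0) δ ≤ indexMinus (empVec X pulls m) (pulls m 0) δ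

/-- The categories whose arms are pulled from the next round on: those that pass the test or, if
none does, all categories. -/
def survivors {M K : ℕ} [NeZero K] (X : Fin M → Fin K → ℕ → ℝ) (δ : ℝ)
    (pulls : Fin M → Fin K → ℕ) (A : Finset (Fin M)) : Finset (Fin M) :=
  if passing X δ pulls A = ∅ then Finset.univ else passing X δ pulls A

/-- The state after arm `a` has been pulled in state `s`. -/
def step {M K : ℕ} [NeZero K] (X : Fin M → Fin K → ℕ → ℝ) (δ : ℝ) (s : State M K)
    (a : Fin M × Fin K) : State M K :=
  let pulls' : Fin M → Fin K → ℕ :=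
    fun m k => if (m, k) = a then s.pulls m k + 1 else s.pulls m k
  if s.pending = ∅ then
    { pulls := pulls', active := s.active, pending := ∅ }
  else if s.pending.erase a = ∅ then
    let A := survivors X δ pulls' s.active
    { pulls := pulls', active := A, pending := if A.card = 1 then ∅ else A ×ˢ Finset.univ }
  else
    { pulls := pulls', active := s.active, pending := s.pending.erase a }

/-- The UCB index of an arm with rewards `x` after `n` pulls. -/
def ucbIndex (x : ℕ → ℝ) (n : ℕ) (δ : ℝ) : ℝ :=
  empMean x n + Real.sqrt (2 * Real.log (1 / δ) / n)

/-- The pulls that the algorithm may make in state `s`: during a round, any arm of that round that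
is still to be pulled; afterwards, an arm of the active category with the largest UCB index. -/
def Allowed {M K : ℕ} (X : Fin M → Fin K → ℕ → ℝ) (δ : ℝ) (s : State M K)
    (a : Fin M × Fin K) : Prop :=
  if s.pending = ∅ then
    a.1 ∈ s.active ∧ ∀ k, ucbIndex (X a.1 k) (s.pulls a.1 k) δ ≤
      ucbIndex (X a.1 a.2) (s.pulls a.1 a.2) δ
  else a ∈ s.pending

/-- The state after the first `t` of the pulls `act 0, act 1, …`. -/
def stateAt {M K : ℕ} [NeZero K] (X : Fin M → Fin K → ℕ → ℝ) (δ : ℝ)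
    (act : ℕ → Fin M × Fin K) : ℕ → State M K
  | 0 => initState M K
  | t + 1 => step X δ (stateAt X δ act t) (act t)

/-- The first `T` of the pulls `act 0, act 1, …` are made by CatSE with parameter `δ` on the
rewards `X`, for some order of the pulls inside each round and some way of breaking ties between
UCB indices. -/
def IsCatSERun {M K : ℕ} [NeZero K] (X : Fin M → Fin K → ℕ → ℝ) (δ : ℝ) (T : ℕ)
    (act : ℕ → Fin M × Fin K) : Prop :=
  ∀ t < T, Allowed X δ (stateAt X δ act t) (act t)

/-- The regret `R_T = ∑_{t ≤ T} (μ_1^1 - μ_{A_t}^{C_t})` of a sequence of pulls. -/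
def regret {M K : ℕ} [NeZero M] [NeZero K] (μ : Fin M → Fin K → ℝ) (T : ℕ)
    (act : ℕ → Fin M × Fin K) : ℝ :=
  ∑ t ∈ Finset.range T, gap μ (act t).1 (act t).2

/-- The regret bound, with `D` in the place of the minimum over pairs of points of the simplex. The
first sum runs over the suboptimal arms of the best category. -/
def regretBound {M K : ℕ} [NeZero M] [NeZero K] (μ : Fin M → Fin K → ℝ) (δ : ℝ) (D : ℝ≥0∞) :
    ℝ≥0∞ :=
  ENNReal.ofReal (∑ k with 0 < gap μ 0 k, 8 * Real.log (1 / δ) / gap μ 0 k)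
    + ENNReal.ofReal (∑ m, ∑ k, gap μ m k)
    + ENNReal.ofReal (8 * (K * Real.log 2 + Real.log (1 / δ)) * ∑ m, ∑ k, gap μ m k) * D

/-- Whatever the rewards are, the algorithm always has a next pull. -/
theorem exists_isCatSERun {M K : ℕ} [NeZero M] [NeZero K] (X : Fin M → Fin K → ℕ → ℝ) (δ : ℝ) :
    ∃ act, ∀ T, IsCatSERun X δ T act := by
  classical
  have hne : ∀ s : State M K, s.active.Nonempty → ∃ a, Allowed X δ s a := by
    intro s ⟨m, hm⟩
    by_cases h : s.pending = ∅
    · obtain ⟨k, hk⟩ := Finite.exists_max fun k => ucbIndex (X m k) (s.pulls m k) δ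
      exact ⟨(m, k), by simp only [Allowed, if_pos h]; exact ⟨hm, hk⟩⟩
    · obtain ⟨a, ha⟩ := Finset.nonempty_iff_ne_empty.2 h
      exact ⟨a, by simpa only [Allowed, if_neg h] using ha⟩
  have hstep : ∀ (s : State M K) a, s.active.Nonempty → (step X δ s a).active.Nonempty := by
    intro s a hs
    simp only [step]
    split_ifs <;> try exact hs
    all_goals
      simp only [survivors]
      split_ifs with h
      · exact Finset.univ_nonempty
      · exact Finset.nonempty_iff_ne_empty.2 h
  let pick : State M K → Fin M × Fin K := fun s => if h : ∃ a, Allowed X δ s a then h.choose else 0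
  let st : ℕ → State M K := fun t => Nat.rec (initState M K) (fun _ s => step X δ s (pick s)) t
  have hst : ∀ t, stateAt X δ (fun t => pick (st t)) t = st t := by
    intro t
    induction t with
    | zero => rfl
    | succ t ih => simp only [stateAt, ih]; rfl
  have hact : ∀ t, (st t).active.Nonempty := by
    intro t
    induction t with
    | zero => exact Finset.univ_nonempty
    | succ t ih => exact hstep _ _ ih
  refine ⟨fun t => pick (st t), fun T t _ => ?_⟩
  rw [hst]
  have h := hne _ (hact t)
  simp only [pick, dif_pos h]
  exact h.choose_spec

end CategorizedBandit

end

/-! On the event `GoodRewards` the run is controlled deterministically. For every number p ≤ T of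
rounds, no category would eliminate category `0`, category `0` would eliminate each other one if p ≥
N, and the needed sides of the confidence bounds for its arms hold. So the elimination phase lasts
at most N rounds and can only end with category `0`. Afterwards an arm of category `0` with gap Δ >
0 has at most N or at most 1 + 8 log(1/δ)/Δ² pulls, and the other arms have at most N
(`regret_le_of_goodRewards`). The choice N = ⌊8 (K log 2 + log(1/δ)) D⌋ + 1 gives the bound.

Separating a category from the best one needs only the tail of a linear form, for one fixed
near-optimal pair (x, y) (`measure_not_separated_le`). The crux is that category `0` survives
(`measure_best_eliminated_le`), because there the optimal weights are random. If L⁺ of n exceeds L⁻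
of `0`, some level c lies strictly between, and Cauchy–Schwarz makes both ∑ (v_k - c)₊² and ∑ (c -
w_k)₊² exceed β². Strong dominance turns this into the same statement about normalized deviations Z,
with a common random level c.

The levels are split at ±2/5 and 0. For |c| ≥ 2/5 one of the sums is already unlikely, since E
exp((Z - 2/5)₊²/2) ≤ 2; without the shift this moment can be infinite. For |c| ≤ 2/5 the two sums
are combined with weights 3/10 and 1/5, of total 1/2, and the product of the two moments stays below
2. The term K log 2 in β pays exactly for the factor 2^K, so each event has probability at most δ.
All failures together cost at most 2MKδ per p. -/

namespace CategorizedBandit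

/-! ### Independence of blocks. -/

/-- Disjoint blocks of an independent family are independent. -/
theorem iIndepFun_curry {Ω ι κ : Type*} [MeasurableSpace Ω] {P : Measure Ω}
    {X : ι → κ → Ω → ℝ} (hmeas : ∀ i j, Measurable (X i j))
    (h : iIndepFun (fun p : ι × κ => X p.1 p.2) P) :
    iIndepFun (fun i ω => fun j => X i j ω) P := by
  have := h.isProbabilityMeasure
  have : ∀ i j, IsProbabilityMeasure (P.map (X i j)) :=
    fun i j => Measure.isProbabilityMeasure_map (hmeas i j).aemeasurable
  have : ∀ i, IsProbabilityMeasure (P.map (fun ω => (X i · ω))) :=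
    fun i => Measure.isProbabilityMeasure_map (Measurable.aemeasurable (by fun_prop))
  have h' : iIndepFun (fun p : (_ : ι) × κ => X p.1 p.2) P :=
    h.precomp (g := fun p : (_ : ι) × κ => (p.1, p.2)) (Equiv.sigmaEquivProd ι κ).injective
  have hrow : ∀ i, iIndepFun (X i) P := fun i =>
    h.precomp (g := fun j => (i, j)) fun a b hab => (Prod.mk.inj hab).2
  rw [iIndepFun_iff_map_fun_eq_infinitePi_map (by fun_prop)] at h' ⊢
  have hc : (MeasurableEquiv.piCurry fun (_ : ι) (_ : κ) => ℝ) ∘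
      (fun ω (p : (_ : ι) × κ) => X p.1 p.2 ω) = fun ω i j => X i j ω := by
    ext; simp [Sigma.curry]
  rw [← hc, ← Measure.map_map (by fun_prop) (by fun_prop), h',
    Measure.infinitePi_map_piCurry (fun i j => P.map (X i j))]
  congr 1
  funext i
  exact ((iIndepFun_iff_map_fun_eq_infinitePi_map (by fun_prop)).1 (hrow i)).symm

/-! ### Exponential moments of squares of sub-Gaussian variables. -/

/-- A Gaussian mixture of exponentials bounds the exponential of a quadratic function of a
sub-Gaussian variable. -/
theorem lintegral_exp_quadratic_le {Ω : Type*} [MeasurableSpace Ω] {P : Measure Ω}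
    [IsProbabilityMeasure P] {Z : Ω → ℝ} (hZm : Measurable Z) (hZ : HasSubgaussianMGF Z 1 P)
    (m : ℝ) {s : ℝ} (hs0 : 0 < s) (hs1 : s < 1) :
    ∫⁻ ω, ENNReal.ofReal (Real.exp (m * Z ω + s * Z ω ^ 2 / 2)) ∂P ≤
      ENNReal.ofReal ((√(1 - s))⁻¹ * Real.exp (m ^ 2 / (2 * (1 - s)))) := by
  have hq : 0 < 1 - s := by linarith
  set v : NNReal := ⟨s, hs0.le⟩
  have hv : v ≠ 0 := by
    intro h; exact hs0.ne' (congrArg NNReal.toReal h)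
  set w : NNReal := ⟨s / (1 - s), by positivity⟩
  have hw : w ≠ 0 := by
    intro h; exact (div_pos hs0 hq).ne' (congrArg NNReal.toReal h)
  have hmix : ∀ z : ℝ, ENNReal.ofReal (Real.exp (m * z + s * z ^ 2 / 2)) =
      ∫⁻ l, ENNReal.ofReal (Real.exp (z * l)) ∂gaussianReal m v := by
    intro z
    have h := congrFun (mgf_fun_id_gaussianReal (μ := m) (v := v)) z
    rw [show m * z + s * z ^ 2 / 2 = m * z + v * z ^ 2 / 2 from rfl, ← h, mgf,
      ofReal_integral_eq_lintegral_ofReal (integrable_exp_mul_gaussianReal z)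
        (ae_of_all _ fun _ => (Real.exp_pos _).le)]
  simp_rw [hmix]
  rw [lintegral_lintegral_swap (by fun_prop)]
  calc ∫⁻ l, ∫⁻ ω, ENNReal.ofReal (Real.exp (Z ω * l)) ∂P ∂gaussianReal m v
      ≤ ∫⁻ l, ENNReal.ofReal (Real.exp (l ^ 2 / 2)) ∂gaussianReal m v := by
        refine lintegral_mono fun l => ?_
        simp_rw [mul_comm _ l]
        rw [← ofReal_integral_eq_lintegral_ofReal (hZ.integrable_exp_mul l)
          (ae_of_all _ fun _ => (Real.exp_pos _).le)]
        refine ENNReal.ofReal_le_ofReal ?_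
        simpa [mgf] using hZ.mgf_le l
    _ = ∫⁻ l, gaussianPDF m v l * ENNReal.ofReal (Real.exp (l ^ 2 / 2)) := by
        rw [gaussianReal_of_var_ne_zero m hv,
          lintegral_withDensity_eq_lintegral_mul _ (measurable_gaussianPDF m v) (by fun_prop)]
        rfl
    _ = ∫⁻ l, ENNReal.ofReal ((√(1 - s))⁻¹ * Real.exp (m ^ 2 / (2 * (1 - s)))) *
          gaussianPDF (m / (1 - s)) w l := by
        refine lintegral_congr fun l => ?_
        rw [gaussianPDF, gaussianPDF, ← ENNReal.ofReal_mul (gaussianPDFReal_nonneg _ _ _),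
          ← ENNReal.ofReal_mul (by positivity)]
        congr 1
        rw [gaussianPDFReal, gaussianPDFReal]
        rw [show (v : ℝ) = s from rfl, show (w : ℝ) = s / (1 - s) from rfl]
        have h1 : √(2 * Real.pi * (s / (1 - s))) = √(2 * Real.pi * s) * (√(1 - s))⁻¹ := by
          rw [← Real.sqrt_inv, ← Real.sqrt_mul (by positivity)]
          congr 1
          rw [div_eq_mul_inv, ← mul_assoc]
        -- Completing the square: since s < 1, the product is again a multiple of a Gaussian
        -- density, of mean m/(1-s) and variance s/(1-s).
        have h2 : -(l - m) ^ 2 / (2 * s) + l ^ 2 / 2 =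
            m ^ 2 / (2 * (1 - s)) + -(l - m / (1 - s)) ^ 2 / (2 * (s / (1 - s))) := by
          field_simp
          ring
        rw [h1, mul_assoc, ← Real.exp_add, h2, Real.exp_add]
        have : √(1 - s) ≠ 0 := (Real.sqrt_pos.2 hq).ne'
        field_simp
    _ = _ := by
        rw [lintegral_const_mul _ (measurable_gaussianPDF _ _), lintegral_gaussianPDF_eq_one _ hw,
          mul_one]

theorem gaussianReal_Iic_zero_le : gaussianReal 0 1 (Set.Iic 0) ≤ ENNReal.ofReal (1 / 2) := by
  have hsymm : gaussianReal 0 1 (Set.Iic 0) = gaussianReal 0 1 (Set.Ici 0) := by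
    have h := gaussianReal_map_neg (μ := 0) (v := 1)
    rw [neg_zero] at h
    conv_lhs => rw [← h]
    rw [Measure.map_apply measurable_neg measurableSet_Iic]
    congr 1
    ext x
    simp
  have hatom : gaussianReal 0 1 (Set.Ici 0) = gaussianReal 0 1 (Set.Ioi 0) := by
    have := nullSingletonClass_gaussianReal (μ := 0) (v := 1) one_ne_zero
    exact measure_congr Ioi_ae_eq_Ici.symm
  have hsum : gaussianReal 0 1 (Set.Iic 0) + gaussianReal 0 1 (Set.Iic 0) = 1 := by
    conv_lhs => rhs; rw [hsymm, hatom]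
    rw [← measure_union (Set.Iic_disjoint_Ioi le_rfl) measurableSet_Ioi, Set.Iic_union_Ioi,
      measure_univ]
  rw [ENNReal.ofReal_div_of_pos two_pos, ENNReal.ofReal_one, ENNReal.ofReal_ofNat,
    ENNReal.le_div_iff_mul_le (by simp) (by simp), mul_two, hsum]

/-- `exp (v ^ 2 / 2)` for `v ≥ 0` as a mixture of the exponentials `exp (l v)` with `l > 0`. -/
theorem exp_half_sq_le {v : ℝ} (hv : 0 ≤ v) :
    ENNReal.ofReal (Real.exp (v ^ 2 / 2)) ≤ ENNReal.ofReal (1 / 2) +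
      ∫⁻ l in Set.Ioi (0 : ℝ), ENNReal.ofReal (Real.exp (l * v)) ∂gaussianReal 0 1 := by
  have h := congrFun (mgf_fun_id_gaussianReal (μ := 0) (v := 1)) v
  have h1 : Real.exp (v ^ 2 / 2) = ∫ l, Real.exp (l * v) ∂gaussianReal 0 1 := by
    simp_rw [mul_comm _ v]
    rw [mgf] at h
    rw [h]
    simp
  have hint : Integrable (fun l => Real.exp (l * v)) (gaussianReal 0 1) := by
    simpa only [mul_comm _ v] using integrable_exp_mul_gaussianReal (μ := 0) (v := 1) v
  rw [h1, ofReal_integral_eq_lintegral_ofReal hint (ae_of_all _ fun _ => (Real.exp_pos _).le),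
    ← lintegral_add_compl _ (measurableSet_Iic (a := (0 : ℝ))), Set.compl_Iic]
  gcongr
  refine le_trans ?_ gaussianReal_Iic_zero_le
  rw [← setLIntegral_one]
  refine setLIntegral_mono measurable_const fun l hl => ?_
  rw [ENNReal.ofReal_le_one, Real.exp_le_one_iff]
  exact mul_nonpos_of_nonpos_of_nonneg hl hv

/-- The truncated exponential square moment at the critical exponent. -/
theorem lintegral_exp_sq_posPart_sub_le {Ω : Type*} [MeasurableSpace Ω] {P : Measure Ω}
    [IsProbabilityMeasure P] {Z : Ω → ℝ} (hZm : Measurable Z) (hZ : HasSubgaussianMGF Z 1 P) :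
    ∫⁻ ω, ENNReal.ofReal (Real.exp (max (Z ω - 2 / 5) 0 ^ 2 / 2)) ∂P ≤ 2 := by
  -- The constant 1 is needed for z ≤ 0; for z ≥ 0 it absorbs the mixture over l ≤ 0, which is at
  -- most 1/2.
  have hpt : ∀ z : ℝ, ENNReal.ofReal (Real.exp (max z 0 ^ 2 / 2)) ≤ 1 +
      ∫⁻ l in Set.Ioi (0 : ℝ), ENNReal.ofReal (Real.exp (l * z)) ∂gaussianReal 0 1 := by
    intro z
    rcases le_total 0 z with hz | hz
    · rw [max_eq_left hz]
      refine (exp_half_sq_le hz).trans ?_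
      gcongr
      rw [ENNReal.ofReal_le_one]
      norm_num
    · rw [max_eq_right hz]
      simp
  have hmix : ∫⁻ ω, ∫⁻ l in Set.Ioi (0 : ℝ), ENNReal.ofReal (Real.exp (l * (Z ω - 2 / 5)))
      ∂gaussianReal 0 1 ∂P ≤ 1 := by
    -- The factor exp(l²/2) from sub-Gaussianity cancels the Gaussian density; only the shift,
    -- through exp(-2l/5), makes the integral over l > 0 converge.
    rw [lintegral_lintegral_swap (by fun_prop)]
    calc ∫⁻ l in Set.Ioi (0 : ℝ), ∫⁻ ω, ENNReal.ofReal (Real.exp (l * (Z ω - 2 / 5))) ∂P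
            ∂gaussianReal 0 1
        ≤ ∫⁻ l in Set.Ioi (0 : ℝ), ENNReal.ofReal (Real.exp (l ^ 2 / 2 - 2 / 5 * l))
            ∂gaussianReal 0 1 := by
          refine lintegral_mono fun l => ?_
          have he : ∀ ω, Real.exp (l * (Z ω - 2 / 5)) =
              Real.exp (l * Z ω) * Real.exp (-(2 / 5 * l)) := by
            intro ω; rw [← Real.exp_add]; congr 1; ring
          simp_rw [he]
          rw [← ofReal_integral_eq_lintegral_ofReal ((hZ.integrable_exp_mul l).mul_const _)
            (ae_of_all _ fun _ => by positivity), integral_mul_const]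
          refine ENNReal.ofReal_le_ofReal ?_
          rw [sub_eq_add_neg, Real.exp_add]
          gcongr
          simpa [mgf] using hZ.mgf_le l
      _ = ∫⁻ l in Set.Ioi (0 : ℝ), ENNReal.ofReal (√(2 * Real.pi))⁻¹ *
            ENNReal.ofReal (Real.exp (-(2 / 5) * l)) := by
          rw [gaussianReal_of_var_ne_zero 0 one_ne_zero, restrict_withDensity measurableSet_Ioi,
            lintegral_withDensity_eq_lintegral_mul _ (measurable_gaussianPDF 0 1) (by fun_prop)]
          refine lintegral_congr fun l => ?_
          rw [Pi.mul_apply, gaussianPDF, gaussianPDFReal, ← ENNReal.ofReal_mul (by positivity),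
            ← ENNReal.ofReal_mul (by positivity), mul_assoc, ← Real.exp_add]
          congr 2
          · simp
          · congr 1
            simp only [NNReal.coe_one]
            ring
      _ = ENNReal.ofReal ((√(2 * Real.pi))⁻¹ * (5 / 2)) := by
          rw [lintegral_const_mul _ (by fun_prop), ← ofReal_integral_eq_lintegral_ofReal
            (integrableOn_exp_mul_Ioi (by norm_num) 0) (ae_of_all _ fun _ => (Real.exp_pos _).le),
            integral_exp_mul_Ioi (by norm_num), ← ENNReal.ofReal_mul (by positivity)]
          norm_num
      _ ≤ 1 := by
          -- The shift 2/5 is chosen so that 5/2 ≤ √(2π), which holds narrowly.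
          rw [ENNReal.ofReal_le_one, inv_mul_le_one₀ (by positivity)]
          refine Real.le_sqrt_of_sq_le ?_
          nlinarith [Real.pi_gt_d2]
  calc _ ≤ ∫⁻ ω, (1 + ∫⁻ l in Set.Ioi (0 : ℝ), ENNReal.ofReal (Real.exp (l * (Z ω - 2 / 5)))
          ∂gaussianReal 0 1) ∂P := lintegral_mono fun ω => hpt _
    _ ≤ 2 := by
        rw [lintegral_add_left measurable_const, lintegral_one, measure_univ,
          show (2 : ℝ≥0∞) = 1 + 1 by norm_num]
        gcongr

/-- A constant plus a quadratic exponential dominates the exponential of a truncated square. -/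
theorem exp_sq_posPart_le (z : ℝ) :
    Real.exp (3 / 10 * max z 0 ^ 2) ≤
      69 / 160 + 3 / 5 * Real.exp (1 / 4 * z + 3 / 5 * z ^ 2 / 2) := by
  rcases le_total z 0 with hz | hz
  · rw [max_eq_right hz]
    -- The minimum, at z = -5/12. The constant 69/160 is what makes 69/160 + (3/5)(1 - 5/96) equal
    -- to 1.
    have h : -(5 / 96 : ℝ) ≤ 1 / 4 * z + 3 / 5 * z ^ 2 / 2 := by nlinarith [sq_nonneg (z + 5 / 12)]
    have h1 := Real.add_one_le_exp (1 / 4 * z + 3 / 5 * z ^ 2 / 2)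
    norm_num
    linarith
  · rw [max_eq_left hz]
    have key : 1 ≤ 69 / 160 * Real.exp (-(3 / 10 * z ^ 2)) + 3 / 5 * Real.exp (1 / 4 * z) := by
      have hcub : ∀ x : ℝ, 0 ≤ x → 1 + x + x ^ 2 / 2 + x ^ 3 / 6 ≤ Real.exp x := by
        intro x hx
        have h := Real.sum_le_exp_of_nonneg hx 4
        simp [Finset.sum_range_succ, Nat.factorial] at h
        linarith
      have h1 := hcub (1 / 4 * z) (by positivity)
      -- Up to 21/10 a polynomial bound for the decaying exponential suffices; beyond, (3/5)
      -- exp(z/4) alone exceeds 1.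
      rcases le_total z (21 / 10) with h2 | h2
      · have h3 : (1 - 3 / 20 * z ^ 2) ^ 2 ≤ Real.exp (-(3 / 10 * z ^ 2)) := by
          have h4 : 1 - 3 / 20 * z ^ 2 ≤ Real.exp (-(3 / 20 * z ^ 2)) := Real.one_sub_le_exp_neg _
          have h5 : 0 ≤ 1 - 3 / 20 * z ^ 2 := by nlinarith
          calc (1 - 3 / 20 * z ^ 2) ^ 2 ≤ Real.exp (-(3 / 20 * z ^ 2)) ^ 2 := by gcongr
            _ = Real.exp (-(3 / 10 * z ^ 2)) := by
              rw [← Real.exp_nat_mul]; congr 1; push_cast; ring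
        have h6 : 0 ≤ z ^ 3 := by positivity
        nlinarith [sq_nonneg (z ^ 2 - 7 / 2), mul_nonneg hz (sub_nonneg.2 h2)]
      · have h3 : (0 : ℝ) ≤ (1 / 4 * z - 21 / 40) := by linarith
        have h4 : (21 / 40 : ℝ) ^ 2 ≤ (1 / 4 * z) ^ 2 := by gcongr; linarith
        have h5 : (21 / 40 : ℝ) ^ 3 ≤ (1 / 4 * z) ^ 3 := by gcongr; linarith
        have h6 := Real.exp_pos (-(3 / 10 * z ^ 2))
        linarith
    have h1 : Real.exp (3 / 10 * z ^ 2) * Real.exp (-(3 / 10 * z ^ 2)) = 1 := by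
      rw [← Real.exp_add]; simp
    have h2 : Real.exp (1 / 4 * z + 3 / 5 * z ^ 2 / 2) =
        Real.exp (3 / 10 * z ^ 2) * Real.exp (1 / 4 * z) := by
      rw [← Real.exp_add]; congr 1; ring
    rw [h2]
    nlinarith [mul_le_mul_of_nonneg_left key (Real.exp_pos (3 / 10 * z ^ 2)).le]

/-! ### Tails of sums of truncated squares. -/

/-- The Chernoff bound for a sum of functions of independent variables. -/
theorem measure_sum_ge_le_prod_lintegral {Ω ι : Type*} [MeasurableSpace Ω] {P : Measure Ω}
    [Fintype ι] {Z : ι → Ω → ℝ} (hZm : ∀ i, Measurable (Z i)) (hind : iIndepFun Z P)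
    {f : ι → ℝ → ℝ} (hf : ∀ i, Measurable (f i)) (a : ℝ) :
    P {ω | a ≤ ∑ i, f i (Z i ω)} ≤ ENNReal.ofReal (Real.exp (-a)) *
      ∏ i, ∫⁻ ω, ENNReal.ofReal (Real.exp (f i (Z i ω))) ∂P := by
  have hprod := lintegral_prod_eq_prod_lintegral_of_indepFun (μ := P) Finset.univ
    (fun i ω => ENNReal.ofReal (Real.exp (f i (Z i ω))))
    (hind.comp (fun i x => ENNReal.ofReal (Real.exp (f i x))) fun i => by fun_prop)
    fun i => by fun_prop
  have hmarkov := meas_ge_le_lintegral_div (μ := P)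
    (f := fun ω => ∏ i, ENNReal.ofReal (Real.exp (f i (Z i ω)))) (by fun_prop)
    (ε := ENNReal.ofReal (Real.exp a)) (by simp [Real.exp_pos]) ENNReal.ofReal_ne_top
  rw [← hprod, Real.exp_neg, ENNReal.ofReal_inv_of_pos (Real.exp_pos a), mul_comm]
  refine le_trans (measure_mono fun ω hω => ?_) hmarkov
  simp only [Set.mem_ofPred_eq] at hω ⊢
  rw [← ENNReal.ofReal_prod_of_nonneg fun i _ => (Real.exp_pos _).le, ← Real.exp_sum]
  exact ENNReal.ofReal_le_ofReal (Real.exp_le_exp.2 hω)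

/-- The term K log 2 of the radius cancels a moment of size 2 per arm. -/
theorem ofReal_exp_neg_mul_two_pow (n : ℕ) (l : ℝ) :
    ENNReal.ofReal (Real.exp (-(n * Real.log 2 + l))) * 2 ^ n = ENNReal.ofReal (Real.exp (-l)) := by
  rw [← ENNReal.ofReal_ofNat 2, ← ENNReal.ofReal_pow (by norm_num),
    ← ENNReal.ofReal_mul (Real.exp_pos _).le]
  congr 1
  rw [neg_add, Real.exp_add, Real.exp_neg, Real.exp_nat_mul, Real.exp_log two_pos]
  field_simp

/-- Chernoff at the critical exponent 1/2. This handles all levels of absolute value at least 2/5 by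
monotonicity. -/
theorem measure_sum_sq_posPart_sub_le {Ω κ : Type*} [MeasurableSpace Ω] {P : Measure Ω}
    [IsProbabilityMeasure P] [Fintype κ] {U : κ → Ω → ℝ} (hUm : ∀ k, Measurable (U k))
    (hind : iIndepFun U P) (hU : ∀ k, HasSubgaussianMGF (U k) 1 P) (l : ℝ) :
    P {ω | 2 * (Fintype.card κ * Real.log 2 + l) < ∑ k, max (U k ω - 2 / 5) 0 ^ 2} ≤
      ENNReal.ofReal (Real.exp (-l)) := by
  have h := measure_sum_ge_le_prod_lintegral hUm hind
    (f := fun _ z => max (z - 2 / 5) 0 ^ 2 / 2) (fun _ => by fun_prop)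
    (Fintype.card κ * Real.log 2 + l)
  refine (measure_mono fun ω hω => ?_).trans (h.trans ?_)
  · simp only [Set.mem_ofPred_eq] at hω ⊢
    rw [← Finset.sum_div]
    linarith
  · rw [← ofReal_exp_neg_mul_two_pow (Fintype.card κ) l]
    gcongr
    exact Finset.prod_le_pow_card _ _ _ fun k _ => lintegral_exp_sq_posPart_sub_le (hUm k) (hU k)

theorem exp_le_inv_one_sub {x : ℝ} (hx : x < 1) : Real.exp x ≤ (1 - x)⁻¹ := by
  rw [← inv_inv (Real.exp x), ← Real.exp_neg]
  exact inv_anti₀ (by linarith) (Real.one_sub_le_exp_neg x)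

theorem lintegral_exp_sq_posPart_le {Ω : Type*} [MeasurableSpace Ω] {P : Measure Ω}
    [IsProbabilityMeasure P] {Z : Ω → ℝ} (hZm : Measurable Z) (hZ : HasSubgaussianMGF Z 1 P) :
    ∫⁻ ω, ENNReal.ofReal (Real.exp (3 / 10 * max (Z ω) 0 ^ 2)) ∂P ≤
      ENNReal.ofReal (1461 / 1000) := by
  have h := lintegral_exp_quadratic_le hZm hZ (1 / 4) (s := 3 / 5) (by norm_num) (by norm_num)
  have hs : (√(1 - 3 / 5 : ℝ))⁻¹ ≤ 15812 / 10000 := by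
    rw [inv_le_comm₀ (by positivity) (by norm_num)]
    exact Real.le_sqrt_of_sq_le (by norm_num)
  have he := exp_le_inv_one_sub (x := (1 / 4) ^ 2 / (2 * (1 - 3 / 5))) (by norm_num)
  calc _ ≤ ∫⁻ ω, (ENNReal.ofReal (69 / 160) + ENNReal.ofReal (3 / 5) *
          ENNReal.ofReal (Real.exp (1 / 4 * Z ω + 3 / 5 * Z ω ^ 2 / 2))) ∂P := by
        refine lintegral_mono fun ω => ?_
        rw [← ENNReal.ofReal_mul (by norm_num), ← ENNReal.ofReal_add (by norm_num) (by positivity)]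
        exact ENNReal.ofReal_le_ofReal (exp_sq_posPart_le _)
    _ ≤ ENNReal.ofReal (69 / 160) + ENNReal.ofReal (3 / 5) *
          ENNReal.ofReal ((√(1 - 3 / 5))⁻¹ * Real.exp ((1 / 4) ^ 2 / (2 * (1 - 3 / 5)))) := by
        rw [lintegral_add_left measurable_const, lintegral_const, measure_univ, mul_one,
          lintegral_const_mul _ (by fun_prop)]
        gcongr
    _ ≤ _ := by
        rw [← ENNReal.ofReal_mul (by norm_num), ← ENNReal.ofReal_add (by norm_num) (by positivity)]
        refine ENNReal.ofReal_le_ofReal ?_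
        calc _ ≤ 69 / 160 + 3 / 5 * ((15812 / 10000 : ℝ) *
              (1 - (1 / 4) ^ 2 / (2 * (1 - 3 / 5)))⁻¹) := by gcongr
          _ ≤ _ := by norm_num

theorem lintegral_exp_sq_posPart_add_le {Ω : Type*} [MeasurableSpace Ω] {P : Measure Ω}
    [IsProbabilityMeasure P] {Z : Ω → ℝ} (hZm : Measurable Z) (hZ : HasSubgaussianMGF Z 1 P) :
    ∫⁻ ω, ENNReal.ofReal (Real.exp (1 / 5 * max (2 / 5 + Z ω) 0 ^ 2)) ∂P ≤
      ENNReal.ofReal (1364 / 1000) := by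
  have h := lintegral_exp_quadratic_le hZm hZ (4 / 25) (s := 2 / 5) (by norm_num) (by norm_num)
  have hs : (√(1 - 2 / 5 : ℝ))⁻¹ ≤ 12911 / 10000 := by
    rw [inv_le_comm₀ (by positivity) (by norm_num)]
    exact Real.le_sqrt_of_sq_le (by norm_num)
  have he := exp_le_inv_one_sub (x := 4 / 125 + (4 / 25) ^ 2 / (2 * (1 - 2 / 5))) (by norm_num)
  calc _ ≤ ∫⁻ ω, ENNReal.ofReal (Real.exp (4 / 125)) *
          ENNReal.ofReal (Real.exp (4 / 25 * Z ω + 2 / 5 * Z ω ^ 2 / 2)) ∂P := by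
        refine lintegral_mono fun ω => ?_
        rw [← ENNReal.ofReal_mul (Real.exp_pos _).le, ← Real.exp_add]
        refine ENNReal.ofReal_le_ofReal (Real.exp_le_exp.2 ?_)
        -- At exponent 1/5 the truncation can be dropped; the square expands into 4/125 plus a
        -- quadratic form with m = 4/25 and s = 2/5.
        have : max (2 / 5 + Z ω) 0 ^ 2 ≤ (2 / 5 + Z ω) ^ 2 := by
          rw [sq_le_sq, abs_of_nonneg (le_max_right _ _)]
          exact max_le (le_abs_self _) (abs_nonneg _)
        nlinarith
    _ ≤ ENNReal.ofReal (Real.exp (4 / 125)) *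
          ENNReal.ofReal ((√(1 - 2 / 5))⁻¹ * Real.exp ((4 / 25) ^ 2 / (2 * (1 - 2 / 5)))) := by
        rw [lintegral_const_mul _ (by fun_prop)]
        gcongr
    _ ≤ _ := by
        rw [← ENNReal.ofReal_mul (Real.exp_pos _).le]
        refine ENNReal.ofReal_le_ofReal ?_
        rw [mul_left_comm, ← Real.exp_add]
        calc _ ≤ (12911 / 10000 : ℝ) *
              (1 - (4 / 125 + (4 / 25) ^ 2 / (2 * (1 - 2 / 5))))⁻¹ := by gcongr
          _ ≤ _ := by norm_num

/-- If both sums exceed the threshold, so does their combination with weights 3/10 and 1/5, up to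
the factor 1/2. The moments satisfy 1.461 · 1.364 < 2, so a joint event on 2K variables still costs
only 2^K. -/
theorem measure_sum_sq_posPart_and_le {Ω κ : Type*} [MeasurableSpace Ω] {P : Measure Ω}
    [IsProbabilityMeasure P] [Fintype κ] {U : κ ⊕ κ → Ω → ℝ} (hUm : ∀ k, Measurable (U k))
    (hind : iIndepFun U P) (hU : ∀ k, HasSubgaussianMGF (U k) 1 P) (l : ℝ) :
    P {ω | 2 * (Fintype.card κ * Real.log 2 + l) < ∑ k, max (U (.inl k) ω) 0 ^ 2 ∧
        2 * (Fintype.card κ * Real.log 2 + l) < ∑ k, max (2 / 5 + U (.inr k) ω) 0 ^ 2} ≤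
      ENNReal.ofReal (Real.exp (-l)) := by
  have h := measure_sum_ge_le_prod_lintegral hUm hind
    (f := Sum.elim (fun _ z => 3 / 10 * max z 0 ^ 2) (fun _ z => 1 / 5 * max (2 / 5 + z) 0 ^ 2))
    (by rintro (i | i) <;> simp only [Sum.elim_inl, Sum.elim_inr] <;> fun_prop)
    (Fintype.card κ * Real.log 2 + l)
  refine (measure_mono fun ω hω => ?_).trans (h.trans ?_)
  · simp only [Set.mem_ofPred_eq, Fintype.sum_sum_type, Sum.elim_inl, Sum.elim_inr] at hω ⊢
    rw [← Finset.mul_sum, ← Finset.mul_sum]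
    linarith
  · rw [← ofReal_exp_neg_mul_two_pow (Fintype.card κ) l]
    gcongr
    simp only [Fintype.prod_sum_type, Sum.elim_inl, Sum.elim_inr]
    calc _ ≤ ENNReal.ofReal (1461 / 1000) ^ Fintype.card κ *
          ENNReal.ofReal (1364 / 1000) ^ Fintype.card κ := by
          gcongr
          · exact Finset.prod_le_pow_card _ _ _ fun k _ => lintegral_exp_sq_posPart_le (hUm _) (hU _)
          · exact Finset.prod_le_pow_card _ _ _ fun k _ =>
              lintegral_exp_sq_posPart_add_le (hUm _) (hU _)
      _ ≤ 2 ^ Fintype.card κ := by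
          rw [← mul_pow, ← ENNReal.ofReal_mul (by norm_num)]
          gcongr
          rw [← ENNReal.ofReal_ofNat 2]
          exact ENNReal.ofReal_le_ofReal (by norm_num)

/-! ### Linear combinations of sub-Gaussian variables. -/

theorem hasSubgaussianMGF_const_mul {Ω : Type*} [MeasurableSpace Ω] {P : Measure Ω}
    {Z : Ω → ℝ} (hZ : HasSubgaussianMGF Z 1 P) (a : ℝ) :
    HasSubgaussianMGF (fun ω => a * Z ω) (Real.toNNReal (a ^ 2)) P := by
  convert hZ.const_mul a using 1
  rw [Real.toNNReal_of_nonneg (sq_nonneg a)]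
  exact (mul_one _).symm

/-- Linear combinations of independent sub-Gaussian variables are sub-Gaussian. -/
theorem hasSubgaussianMGF_sum_mul {Ω ι : Type*} [MeasurableSpace Ω] {P : Measure Ω}
    {Z : ι → Ω → ℝ} (hind : iIndepFun Z P) (hZ : ∀ i, HasSubgaussianMGF (Z i) 1 P)
    (s : Finset ι) (a : ι → ℝ) {d : ℝ} (ha : ∑ i ∈ s, a i ^ 2 ≤ d) :
    HasSubgaussianMGF (fun ω => ∑ i ∈ s, a i * Z i ω) d.toNNReal P := by
  have h := HasSubgaussianMGF.sum_of_iIndepFun (s := s)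
    (hind.comp (fun i x => a i * x) fun i => by fun_prop)
    (fun i _ => hasSubgaussianMGF_const_mul (hZ i) (a i))
  refine ⟨h.integrable_exp_mul, fun t => (h.mgf_le t).trans (Real.exp_le_exp.2 ?_)⟩
  have h0 : 0 ≤ ∑ i ∈ s, a i ^ 2 := Finset.sum_nonneg fun i _ => sq_nonneg _
  rw [Real.coe_toNNReal _ (h0.trans ha), NNReal.coe_sum]
  simp only [Real.coe_toNNReal _ (sq_nonneg _)]
  gcongr

/-- The sub-Gaussian tail of a linear combination of independent variables. -/
theorem measure_linear_gt_le {Ω ι : Type*} [MeasurableSpace Ω] {P : Measure Ω}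
    [IsProbabilityMeasure P] [Fintype ι] {Z : ι → Ω → ℝ} (hind : iIndepFun Z P)
    (hZ : ∀ i, HasSubgaussianMGF (Z i) 1 P) (a : ι → ℝ) {ρ l : ℝ} (hρ : 0 < ρ) (hl : 0 ≤ l)
    (ha : ∑ i, a i ^ 2 ≤ ρ ^ 2) :
    P {ω | ρ * √(2 * l) < ∑ i, a i * Z i ω} ≤ ENNReal.ofReal (Real.exp (-l)) := by
  have h := (hasSubgaussianMGF_sum_mul hind hZ Finset.univ a ha).measure_ge_le
    (ε := ρ * √(2 * l)) (by positivity)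
  have he : -(ρ * √(2 * l)) ^ 2 / (2 * (Real.toNNReal (ρ ^ 2) : ℝ)) = -l := by
    rw [mul_pow, Real.sq_sqrt (by positivity), Real.coe_toNNReal _ (sq_nonneg ρ)]
    field_simp
  rw [he, measureReal_def] at h
  refine (measure_mono fun ω hω => ?_).trans (ENNReal.le_ofReal_iff_toReal_le (measure_ne_top P _)
    (Real.exp_pos _).le |>.2 h)
  simp only [Set.mem_ofPred_eq] at hω ⊢
  exact hω.le

/-! ### The simplex, the radius and the two indices. -/

theorem norm2_sq {K : ℕ} (x : Fin K → ℝ) : norm2 x ^ 2 = ∑ k, x k ^ 2 := by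
  rw [norm2, EuclideanSpace.norm_sq_eq]
  simp

theorem norm2_nonneg {K : ℕ} (x : Fin K → ℝ) : 0 ≤ norm2 x := norm_nonneg _

theorem norm2_pos {K : ℕ} {x : Fin K → ℝ} (hx : x ∈ stdSimplex ℝ (Fin K)) : 0 < norm2 x := by
  refine (norm2_nonneg x).lt_of_ne fun h => ?_
  have h1 := norm2_sq x
  rw [← h, zero_pow two_ne_zero, eq_comm,
    Finset.sum_eq_zero_iff_of_nonneg fun k _ => sq_nonneg (x k)] at h1
  have h2 := hx.2
  rw [Finset.sum_eq_zero fun k hk => by simpa using h1 k hk] at h2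
  exact zero_ne_one h2

theorem dotProduct_le_norm2_mul {K : ℕ} (x z : Fin K → ℝ) :
    x ⬝ᵥ z ≤ norm2 x * √(∑ k, z k ^ 2) := by
  have h := Real.sum_mul_le_sqrt_mul_sqrt Finset.univ x z
  rwa [← norm2_sq, Real.sqrt_sq (norm2_nonneg x)] at h

theorem dotProduct_sub_const {K : ℕ} {x : Fin K → ℝ} (hx : x ∈ stdSimplex ℝ (Fin K))
    (v : Fin K → ℝ) (c : ℝ) : ∑ k, x k * (v k - c) = x ⬝ᵥ v - c := by
  simp only [mul_sub, Finset.sum_sub_distrib, ← Finset.sum_mul, hx.2, one_mul]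
  rfl

/-- Weights are nonnegative and sum to 1, so ⟨x, v⟩ - c ≤ ⟨x, (v - c)₊⟩, and Cauchy–Schwarz removes
the unknown x. -/
theorem sq_lt_sum_sq_posPart {K : ℕ} {x v : Fin K → ℝ} (hx : x ∈ stdSimplex ℝ (Fin K))
    {r c : ℝ} (hr : 0 ≤ r) (h : c < x ⬝ᵥ v - norm2 x * r) :
    r ^ 2 < ∑ k, max (v k - c) 0 ^ 2 := by
  have h1 : x ⬝ᵥ v - c ≤ norm2 x * √(∑ k, max (v k - c) 0 ^ 2) := by
    rw [← dotProduct_sub_const hx]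
    refine le_trans (Finset.sum_le_sum fun k _ => ?_) (dotProduct_le_norm2_mul x _)
    exact mul_le_mul_of_nonneg_left (le_max_left _ _) (hx.1 k)
  exact (Real.lt_sqrt hr).1 (lt_of_mul_lt_mul_left (by linarith) (norm2_nonneg x))

theorem radius_nonneg (K p : ℕ) (δ : ℝ) : 0 ≤ radius K p δ := Real.sqrt_nonneg _

/-- `K log 2 + log (1 / δ)`. -/
noncomputable def logCost (K : ℕ) (δ : ℝ) : ℝ := K * Real.log 2 + Real.log (1 / δ)

theorem log_one_div_pos {δ : ℝ} (hδ0 : 0 < δ) (hδ1 : δ < 1) : 0 < Real.log (1 / δ) :=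
  Real.log_pos (by rw [lt_div_iff₀ hδ0]; linarith)

theorem log_one_div_le_logCost (K : ℕ) (δ : ℝ) : Real.log (1 / δ) ≤ logCost K δ := by
  have : 0 ≤ (K : ℝ) * Real.log 2 := mul_nonneg (Nat.cast_nonneg K) (Real.log_nonneg one_le_two)
  rw [logCost]
  linarith

theorem logCost_pos (K : ℕ) {δ : ℝ} (hδ0 : 0 < δ) (hδ1 : δ < 1) : 0 < logCost K δ :=
  (log_one_div_pos hδ0 hδ1).trans_le (log_one_div_le_logCost K δ)

theorem sqrt_mul_radius {K p : ℕ} {δ : ℝ} (hp : 0 < p) :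
    √p * radius K p δ = √(2 * logCost K δ) := by
  have : (0 : ℝ) < p := by exact_mod_cast hp
  rw [radius, ← Real.sqrt_mul this.le, logCost]
  congr 1
  field_simp

theorem exists_simplex_of_indexMinus_lt_indexPlus {K p : ℕ} [NeZero K] {v w : Fin K → ℝ} {δ : ℝ}
    (h : indexMinus w p δ < indexPlus v p δ) :
    ∃ x ∈ stdSimplex ℝ (Fin K), ∃ y ∈ stdSimplex ℝ (Fin K),
      y ⬝ᵥ w + norm2 y * radius K p δ < x ⬝ᵥ v - norm2 x * radius K p δ := by
  have : Nonempty (stdSimplex ℝ (Fin K)) := ⟨⟨_, single_mem_stdSimplex ℝ (0 : Fin K)⟩⟩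
  obtain ⟨c, hc1, hc2⟩ := exists_between h
  obtain ⟨y, hy⟩ := exists_lt_of_ciInf_lt hc1
  obtain ⟨x, hx⟩ := exists_lt_of_lt_ciSup hc2
  exact ⟨x, x.2, y, y.2, hy.trans hx⟩

/-- A number between the two indices decouples the categories: the random weights are replaced by
one scalar. -/
theorem exists_level_of_indexMinus_lt_indexPlus {K p : ℕ} [NeZero K] {v w : Fin K → ℝ} {δ : ℝ}
    (h : indexMinus w p δ < indexPlus v p δ) :
    ∃ c, radius K p δ ^ 2 < ∑ k, max (v k - c) 0 ^ 2 ∧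
      radius K p δ ^ 2 < ∑ k, max (c - w k) 0 ^ 2 := by
  obtain ⟨x, hx, y, hy, hxy⟩ := exists_simplex_of_indexMinus_lt_indexPlus h
  obtain ⟨c, hc1, hc2⟩ := exists_between hxy
  refine ⟨c, sq_lt_sum_sq_posPart hx (radius_nonneg _ _ _) hc2, ?_⟩
  have h1 := sq_lt_sum_sq_posPart (v := -w) (c := -c) hy (radius_nonneg K p δ)
    (by rw [dotProduct_neg]; linarith)
  simpa only [Pi.neg_apply, neg_sub_neg] using h1

/-! ### Normalized deviations of empirical means. -/

section Deviations

variable {M K : ℕ} {Ω : Type*}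

/-- The deviation of the mean of the first `p` rewards of an arm, scaled to unit variance proxy. -/
noncomputable def dev (μ : Fin M → Fin K → ℝ) (X : Fin M → Fin K → ℕ → Ω → ℝ) (p : ℕ)
    (i : Fin M × Fin K) (ω : Ω) : ℝ :=
  √p * (empMean (fun r => X i.1 i.2 r ω) p - μ i.1 i.2)

theorem dev_eq_sum (μ : Fin M → Fin K → ℝ) (X : Fin M → Fin K → ℕ → Ω → ℝ) {p : ℕ} (hp : 0 < p)
    (i : Fin M × Fin K) (ω : Ω) :
    dev μ X p i ω = ∑ r ∈ Finset.range p, (√p)⁻¹ * (X i.1 i.2 r ω - μ i.1 i.2) := by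
  have hp' : (0 : ℝ) < p := by exact_mod_cast hp
  rw [← Finset.mul_sum, Finset.sum_sub_distrib, Finset.sum_const, Finset.card_range, nsmul_eq_mul,
    dev, empMean]
  have h1 : √(p : ℝ) ≠ 0 := (Real.sqrt_pos.2 hp').ne'
  have h2 : √(p : ℝ) ^ 2 = p := Real.sq_sqrt hp'.le
  field_simp
  rw [h2]

variable [MeasurableSpace Ω] {P : Measure Ω} {μ : Fin M → Fin K → ℝ}
  {X : Fin M → Fin K → ℕ → Ω → ℝ}

theorem measurable_dev (hmeas : ∀ m k r, Measurable (X m k r)) {p : ℕ} (hp : 0 < p)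
    (i : Fin M × Fin K) : Measurable (dev μ X p i) := by
  rw [show dev μ X p i = _ from funext (dev_eq_sum μ X hp i)]
  have := hmeas
  fun_prop

theorem iIndepFun_dev (hmeas : ∀ m k r, Measurable (X m k r))
    (hindep : iIndepFun (fun i : Fin M × Fin K × ℕ => X i.1 i.2.1 i.2.2) P) {p : ℕ} (hp : 0 < p) :
    iIndepFun (dev μ X p) P := by
  have h1 : iIndepFun (fun q : (Fin M × Fin K) × ℕ => X q.1.1 q.1.2 q.2) P :=
    hindep.precomp (g := fun q : (Fin M × Fin K) × ℕ => (q.1.1, q.1.2, q.2))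
      (Equiv.prodAssoc _ _ _).injective
  have h2 := iIndepFun_curry (X := fun (i : Fin M × Fin K) r => X i.1 i.2 r)
    (fun i r => hmeas _ _ _) h1
  have h3 := h2.comp
    (fun i (x : ℕ → ℝ) => ∑ r ∈ Finset.range p, (√p)⁻¹ * (x r - μ i.1 i.2)) fun i => by fun_prop
  convert h3 using 1
  funext i ω
  exact dev_eq_sum μ X hp i ω

theorem hasSubgaussianMGF_dev
    (hindep : iIndepFun (fun i : Fin M × Fin K × ℕ => X i.1 i.2.1 i.2.2) P)
    (hsub : ∀ m k r, HasSubgaussianMGF (fun ω => X m k r ω - μ m k) 1 P) {p : ℕ} (hp : 0 < p)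
    (i : Fin M × Fin K) : HasSubgaussianMGF (dev μ X p i) 1 P := by
  have hp' : (0 : ℝ) < p := by exact_mod_cast hp
  have h1 : iIndepFun (fun r => X i.1 i.2 r) P :=
    hindep.precomp (g := fun r : ℕ => (i.1, i.2, r)) fun a b h => by simpa using h
  have h2 : iIndepFun (fun r ω => X i.1 i.2 r ω - μ i.1 i.2) P :=
    h1.comp (fun r x => x - μ i.1 i.2) fun r => by fun_prop
  have h3 := hasSubgaussianMGF_sum_mul h2 (hsub i.1 i.2) (Finset.range p) (fun _ => (√p)⁻¹)
    (d := 1) (by simp [Real.sq_sqrt hp'.le, hp'.ne'])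
  rw [Real.toNNReal_one] at h3
  rwa [show dev μ X p i = _ from funext (dev_eq_sum μ X hp i)]

end Deviations

/-! ### Union bounds over categories and levels. -/

theorem measure_exists_mem_le {Ω ι : Type*} [MeasurableSpace Ω] {P : Measure Ω} (s : Finset ι)
    (p : ι → Ω → Prop) {c : ℝ≥0∞} (h : ∀ i ∈ s, P {ω | p i ω} ≤ c) :
    P {ω | ∃ i ∈ s, p i ω} ≤ s.card * c := by
  have : {ω | ∃ i ∈ s, p i ω} = ⋃ i ∈ s, {ω | p i ω} := by ext; simp
  rw [this, ← nsmul_eq_mul]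
  exact (measure_biUnion_finset_le s _).trans (Finset.sum_le_card_nsmul _ _ _ h)

theorem measure_or_le {Ω : Type*} [MeasurableSpace Ω] {P : Measure Ω} {p q : Ω → Prop}
    {a b : ℝ≥0∞} (hp : P {ω | p ω} ≤ a) (hq : P {ω | q ω} ≤ b) :
    P {ω | p ω ∨ q ω} ≤ a + b :=
  (measure_union_le {ω | p ω} {ω | q ω}).trans (add_le_add hp hq)

section

variable {M K : ℕ} [NeZero M] {Ω : Type*} [MeasurableSpace Ω] {P : Measure Ω}
  [IsProbabilityMeasure P] {Z : Fin M × Fin K → Ω → ℝ}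

theorem measure_rows_gt_le (hind : iIndepFun Z P) (hZ : ∀ i, HasSubgaussianMGF (Z i) 1 P)
    {n : Fin M} (hn : n ≠ 0) {x y : Fin K → ℝ} (hx : x ∈ stdSimplex ℝ (Fin K)) {l : ℝ} (hl : 0 ≤ l) :
    P {ω | (norm2 x + norm2 y) * √(2 * l) <
        ∑ k, x k * Z (n, k) ω - ∑ k, y k * Z (0, k) ω} ≤ ENNReal.ofReal (Real.exp (-l)) := by
  set a : Fin M × Fin K → ℝ := fun i => if i.1 = n then x i.2 else if i.1 = 0 then -y i.2 else 0
  have hpos : 0 < norm2 x + norm2 y := add_pos_of_pos_of_nonneg (norm2_pos hx) (norm2_nonneg y)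
  have hrows : ∀ f : Fin M × Fin K → ℝ, (∀ m k, m ≠ n → m ≠ 0 → f (m, k) = 0) →
      ∑ i, f i = ∑ k, f (n, k) + ∑ k, f (0, k) := by
    intro f hf
    rw [Fintype.sum_prod_type, Fintype.sum_eq_add n 0 hn]
    rintro m ⟨h1, h2⟩
    exact Finset.sum_eq_zero fun k _ => hf m k h1 h2
  -- The rows are disjoint, so the left side is ‖x‖² + ‖y‖²; the cross term is given away.
  have hsq : ∑ i, a i ^ 2 ≤ (norm2 x + norm2 y) ^ 2 := by
    rw [hrows _ fun m k h1 h2 => by simp [a, h1, h2]]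
    simp only [a, if_true, if_neg hn.symm, neg_sq, ← norm2_sq]
    nlinarith [norm2_nonneg x, norm2_nonneg y, mul_nonneg (norm2_nonneg x) (norm2_nonneg y)]
  refine le_trans (measure_mono fun ω hω => ?_) (measure_linear_gt_le hind hZ a hpos hl hsq)
  simp only [Set.mem_ofPred_eq] at hω ⊢
  rw [hrows _ fun m k h1 h2 => by simp [a, h1, h2]]
  simpa [a, hn.symm, sub_eq_add_neg] using hω

/-- Monotonicity in c reduces the continuum of levels to four ranges. The outer ranges cost one
event per category, that of category `0` being shared by all n, and the inner ones two events for
each n ≠ 0. -/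
theorem measure_exists_level_le (hZm : ∀ i, Measurable (Z i)) (hind : iIndepFun Z P)
    (hZ : ∀ i, HasSubgaussianMGF (Z i) 1 P) (l : ℝ) :
    P {ω | ∃ n ∈ Finset.univ.erase (0 : Fin M), ∃ c : ℝ,
        2 * (K * Real.log 2 + l) < ∑ k, max (Z (n, k) ω - c) 0 ^ 2 ∧
        2 * (K * Real.log 2 + l) < ∑ k, max (c - Z (0, k) ω) 0 ^ 2} ≤
      ((M + 2 * (M - 1) : ℕ) : ℝ≥0∞) * ENNReal.ofReal (Real.exp (-l)) := by
  set r : ℝ := 2 * (K * Real.log 2 + l)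
  set ε := ENNReal.ofReal (Real.exp (-l))
  have hrow : ∀ m : Fin M, Function.Injective fun k : Fin K => (m, k) :=
    fun m a b h => (Prod.mk.inj h).2
  have hpair : ∀ n : Fin M, n ≠ 0 →
      Function.Injective (Sum.elim (fun k : Fin K => (n, k)) fun k => ((0 : Fin M), k)) ∧
      Function.Injective (Sum.elim (fun k : Fin K => ((0 : Fin M), k)) fun k => (n, k)) := by
    intro n hn
    constructor <;> refine Function.Injective.sumElim (hrow _) (hrow _) fun a b h => ?_
    · exact hn (Prod.mk.inj h).1
    · exact hn (Prod.mk.inj h).1.symm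
  -- Flipping the sign of category `0` makes the dangerous direction upward in every category.
  set σ : Fin M → ℝ := fun m => if m = 0 then -1 else 1
  set Y : Fin M × Fin K → Ω → ℝ := fun i ω => σ i.1 * Z i ω
  have hYm : ∀ i, Measurable (Y i) := fun i => (hZm i).const_mul _
  have hYind : iIndepFun Y P := hind.comp (fun i x => σ i.1 * x) fun i => by fun_prop
  have hY : ∀ i, HasSubgaussianMGF (Y i) 1 P := by
    intro i
    have h := hasSubgaussianMGF_const_mul (hZ i) (σ i.1)
    have h1 : σ i.1 ^ 2 = 1 := by
      simp only [σ]
      split_ifs <;> norm_num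
    rwa [h1, Real.toNNReal_one] at h
  have hend : ∀ m ∈ (Finset.univ : Finset (Fin M)),
      P {ω | r < ∑ k, max (Y (m, k) ω - 2 / 5) 0 ^ 2} ≤ ε := by
    intro m _
    have h := measure_sum_sq_posPart_sub_le (P := P) (U := fun k => Y (m, k)) (fun k => hYm _)
      (hYind.precomp (hrow m)) (fun k => hY _) l
    rwa [Fintype.card_fin] at h
  have hmid1 : ∀ n ∈ Finset.univ.erase (0 : Fin M),
      P {ω | r < ∑ k, max (Y (n, k) ω) 0 ^ 2 ∧ r < ∑ k, max (2 / 5 + Y (0, k) ω) 0 ^ 2} ≤ ε := by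
    intro n hn
    have h := measure_sum_sq_posPart_and_le (P := P)
      (U := fun j => Y (Sum.elim (fun k : Fin K => (n, k)) (fun k => ((0 : Fin M), k)) j))
      (fun k => hYm _) (hYind.precomp (hpair n (Finset.ne_of_mem_erase hn)).1) (fun k => hY _) l
    rwa [Fintype.card_fin] at h
  have hmid2 : ∀ n ∈ Finset.univ.erase (0 : Fin M),
      P {ω | r < ∑ k, max (Y (0, k) ω) 0 ^ 2 ∧ r < ∑ k, max (2 / 5 + Y (n, k) ω) 0 ^ 2} ≤ ε := by
    intro n hn
    have h := measure_sum_sq_posPart_and_le (P := P)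
      (U := fun j => Y (Sum.elim (fun k : Fin K => ((0 : Fin M), k)) (fun k => (n, k)) j))
      (fun k => hYm _) (hYind.precomp (hpair n (Finset.ne_of_mem_erase hn)).2) (fun k => hY _) l
    rwa [Fintype.card_fin] at h
  have hall := measure_or_le (measure_exists_mem_le _ _ hend)
    (measure_or_le (measure_exists_mem_le _ _ hmid1) (measure_exists_mem_le _ _ hmid2))
  refine (measure_mono fun ω hω => ?_).trans (hall.trans (le_of_eq ?_))
  · simp only [Set.mem_ofPred_eq] at hω ⊢
    obtain ⟨n, hn, c, h1, h2⟩ := hω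
    have hn0 := Finset.ne_of_mem_erase hn
    have hYn : ∀ k, Y (n, k) ω = Z (n, k) ω := fun k => by simp [Y, σ, hn0]
    have hY0 : ∀ k, Y (0, k) ω = -Z (0, k) ω := fun k => by simp [Y, σ]
    have hmono : ∀ u v : Fin K → ℝ, (∀ k, u k ≤ v k) → r < ∑ k, max (u k) 0 ^ 2 →
        r < ∑ k, max (v k) 0 ^ 2 := by
      intro u v huv h
      refine h.trans_le (Finset.sum_le_sum fun k _ => ?_)
      have := huv k
      gcongr
    rcases le_total (2 / 5) c with hc | hc
    · exact Or.inl ⟨n, Finset.mem_univ n, hmono _ _ (fun k => by rw [hYn]; linarith) h1⟩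
    rcases le_total c (-(2 / 5)) with hc' | hc'
    · exact Or.inl ⟨0, Finset.mem_univ 0, hmono _ _ (fun k => by rw [hY0]; linarith) h2⟩
    rcases le_total 0 c with hc0 | hc0
    · exact Or.inr <| Or.inl ⟨n, hn, hmono _ _ (fun k => by rw [hYn]; linarith) h1,
        hmono _ _ (fun k => by rw [hY0]; linarith) h2⟩
    · exact Or.inr <| Or.inr ⟨n, hn, hmono _ _ (fun k => by rw [hY0]; linarith) h2,
        hmono _ _ (fun k => by rw [hYn]; linarith) h1⟩
  · rw [Finset.card_erase_of_mem (Finset.mem_univ _), Finset.card_univ, Fintype.card_fin]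
    push_cast
    ring

end

/-! ### Failure probabilities for a fixed number of rounds. -/

/-- The vector of empirical means of the arms of category `m` after `p` rounds. -/
noncomputable def roundVec {M K : ℕ} (x : Fin M → Fin K → ℕ → ℝ) (p : ℕ) (m : Fin M) :
    Fin K → ℝ :=
  fun k => empMean (x m k) p

theorem exp_neg_log_one_div {δ : ℝ} (hδ0 : 0 < δ) : Real.exp (-Real.log (1 / δ)) = δ := by
  rw [one_div, Real.log_inv, neg_neg, Real.exp_log hδ0]

theorem sum_mul_dev {M K : ℕ} {Ω : Type*} (μ : Fin M → Fin K → ℝ)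
    (X : Fin M → Fin K → ℕ → Ω → ℝ) (x : Fin K → ℝ) (p : ℕ) (m : Fin M) (ω : Ω) :
    ∑ k, x k * dev μ X p (m, k) ω =
      √p * (x ⬝ᵥ roundVec (fun m k r => X m k r ω) p m - x ⬝ᵥ μ m) := by
  simp only [dev, roundVec, dotProduct, ← Finset.sum_sub_distrib, Finset.mul_sum]
  exact Finset.sum_congr rfl fun k _ => by ring

theorem dotProduct_le_dotProduct_of_stronglyDominates {K : ℕ} {u v x y : Fin K → ℝ}
    (h : StronglyDominates u v) (hx : x ∈ stdSimplex ℝ (Fin K)) (hy : y ∈ stdSimplex ℝ (Fin K)) :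
    x ⬝ᵥ v ≤ y ⬝ᵥ u := by
  have h1 : ∀ k, x ⬝ᵥ v ≤ u k := by
    intro k
    calc x ⬝ᵥ v ≤ ∑ l, x l * u k :=
          Finset.sum_le_sum fun l _ => mul_le_mul_of_nonneg_left (h k l) (hx.1 l)
      _ = u k := by rw [← Finset.sum_mul, hx.2, one_mul]
  calc x ⬝ᵥ v = ∑ k, y k * (x ⬝ᵥ v) := by rw [← Finset.sum_mul, hy.2, one_mul]
    _ ≤ y ⬝ᵥ u := Finset.sum_le_sum fun k _ => mul_le_mul_of_nonneg_left (h1 k) (hy.1 k)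

theorem abs_dotProduct_le {K : ℕ} {x : Fin K → ℝ} (hx : x ∈ stdSimplex ℝ (Fin K))
    (v : Fin K → ℝ) : |x ⬝ᵥ v| ≤ ∑ k, |v k| := by
  refine (Finset.abs_sum_le_sum_abs _ _).trans (Finset.sum_le_sum fun k _ => ?_)
  rw [abs_mul, abs_of_nonneg (hx.1 k)]
  exact mul_le_of_le_one_left (abs_nonneg _)
    (hx.2 ▸ Finset.single_le_sum (fun j _ => hx.1 j) (Finset.mem_univ k))

theorem le_indexPlus {K : ℕ} {x : Fin K → ℝ} (hx : x ∈ stdSimplex ℝ (Fin K)) (v : Fin K → ℝ)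
    (p : ℕ) (δ : ℝ) : x ⬝ᵥ v - norm2 x * radius K p δ ≤ indexPlus v p δ := by
  refine le_ciSup (f := fun x : stdSimplex ℝ (Fin K) =>
    ((x : Fin K → ℝ) ⬝ᵥ v - norm2 (x : Fin K → ℝ) * radius K p δ)) ?_ ⟨x, hx⟩
  refine ⟨∑ k, |v k|, ?_⟩
  rintro _ ⟨y, rfl⟩
  have h1 : (y : Fin K → ℝ) ⬝ᵥ v ≤ ∑ k, |v k| := (abs_le.1 (abs_dotProduct_le y.2 v)).2
  have h2 := mul_nonneg (norm2_nonneg (y : Fin K → ℝ)) (radius_nonneg K p δ)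
  simp only
  linarith

theorem indexMinus_le {K : ℕ} {y : Fin K → ℝ} (hy : y ∈ stdSimplex ℝ (Fin K)) (v : Fin K → ℝ)
    (p : ℕ) (δ : ℝ) : indexMinus v p δ ≤ y ⬝ᵥ v + norm2 y * radius K p δ := by
  refine ciInf_le (f := fun y : stdSimplex ℝ (Fin K) =>
    ((y : Fin K → ℝ) ⬝ᵥ v + norm2 (y : Fin K → ℝ) * radius K p δ)) ?_ ⟨y, hy⟩
  refine ⟨-∑ k, |v k|, ?_⟩
  rintro _ ⟨x, rfl⟩
  have h1 : -∑ k, |v k| ≤ (x : Fin K → ℝ) ⬝ᵥ v := (abs_le.1 (abs_dotProduct_le x.2 v)).1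
  have h2 := mul_nonneg (norm2_nonneg (x : Fin K → ℝ)) (radius_nonneg K p δ)
  simp only
  linarith

section

variable {M K : ℕ} [NeZero M] {Ω : Type*} [MeasurableSpace Ω] {P : Measure Ω}
  [IsProbabilityMeasure P] {μ : Fin M → Fin K → ℝ} {X : Fin M → Fin K → ℕ → Ω → ℝ} {δ : ℝ} {p : ℕ}

/-- A separated category is eliminated by the best one with high probability. -/
theorem measure_not_separated_le (hmeas : ∀ m k r, Measurable (X m k r))
    (hindep : iIndepFun (fun i : Fin M × Fin K × ℕ => X i.1 i.2.1 i.2.2) P)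
    (hsub : ∀ m k r, HasSubgaussianMGF (fun ω => X m k r ω - μ m k) 1 P)
    (hδ0 : 0 < δ) (hδ1 : δ < 1) (hp : 0 < p) {m : Fin M} (hm : m ≠ 0) {x y : Fin K → ℝ}
    (hx : x ∈ stdSimplex ℝ (Fin K)) (hy : y ∈ stdSimplex ℝ (Fin K))
    (hxy : 2 * radius K p δ * (norm2 x + norm2 y) < x ⬝ᵥ μ 0 - y ⬝ᵥ μ m) :
    P {ω | indexPlus (roundVec (fun m k r => X m k r ω) p 0) p δ ≤
        indexMinus (roundVec (fun m k r => X m k r ω) p m) p δ} ≤ ENNReal.ofReal δ := by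
  have h := measure_rows_gt_le (iIndepFun_dev (μ := μ) hmeas hindep hp)
    (hasSubgaussianMGF_dev hindep hsub hp) hm hy (y := x) (logCost_pos K hδ0 hδ1).le
  refine (measure_mono fun ω hω => ?_).trans (h.trans (ENNReal.ofReal_le_ofReal ?_))
  · simp only [Set.mem_ofPred_eq] at hω ⊢
    have h1 := le_indexPlus hx (roundVec (fun m k r => X m k r ω) p 0) p δ
    have h2 := indexMinus_le hy (roundVec (fun m k r => X m k r ω) p m) p δ
    rw [sum_mul_dev, sum_mul_dev, ← sqrt_mul_radius hp, ← mul_sub, mul_left_comm]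
    refine mul_lt_mul_of_pos_left ?_ (Real.sqrt_pos.2 (by exact_mod_cast hp))
    linarith
  · conv_rhs => rw [← exp_neg_log_one_div hδ0]
    exact Real.exp_le_exp.2 (neg_le_neg (log_one_div_le_logCost K δ))

/-- The best category is eliminated with low probability. -/
theorem measure_best_eliminated_le [NeZero K] (hmeas : ∀ m k r, Measurable (X m k r))
    (hindep : iIndepFun (fun i : Fin M × Fin K × ℕ => X i.1 i.2.1 i.2.2) P)
    (hsub : ∀ m k r, HasSubgaussianMGF (fun ω => X m k r ω - μ m k) 1 P)
    (hdom : ∀ m, m ≠ 0 → StronglyDominates (μ 0) (μ m))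
    (hδ0 : 0 < δ) (hδ1 : δ < 1) (hp : 0 < p) :
    P {ω | ∃ n ∈ Finset.univ.erase (0 : Fin M),
        indexMinus (roundVec (fun m k r => X m k r ω) p 0) p δ <
          indexPlus (roundVec (fun m k r => X m k r ω) p n) p δ} ≤
      ((if K = 1 then M - 1 else M + 2 * (M - 1) : ℕ) : ℝ≥0∞) * ENNReal.ofReal δ := by
  have hp' : (0 : ℝ) < √p := Real.sqrt_pos.2 (by exact_mod_cast hp)
  have hind := iIndepFun_dev (μ := μ) hmeas hindep hp
  have hsubG := hasSubgaussianMGF_dev hindep hsub hp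
  split_ifs with hK
  · subst hK
    have hcard : (Finset.univ.erase (0 : Fin M)).card = M - 1 := by simp
    rw [← hcard]
    refine measure_exists_mem_le _ _ fun n hn => ?_
    have hn0 := Finset.ne_of_mem_erase hn
    have hone : ∀ x ∈ stdSimplex ℝ (Fin 1), x = fun _ => 1 := by
      intro x hx
      funext k
      have := hx.2
      rwa [Fin.sum_univ_one, ← Subsingleton.elim k 0] at this
    have hmem : (fun _ => 1 : Fin 1 → ℝ) ∈ stdSimplex ℝ (Fin 1) := ⟨fun _ => zero_le_one, by simp⟩
    have h := measure_rows_gt_le hind hsubG hn0 hmem (y := fun _ => 1) (logCost_pos 1 hδ0 hδ1).le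
    refine (measure_mono fun ω hω => ?_).trans (h.trans (ENNReal.ofReal_le_ofReal ?_))
    · simp only [Set.mem_ofPred_eq] at hω ⊢
      obtain ⟨x, hx, y, hy, hxy⟩ := exists_simplex_of_indexMinus_lt_indexPlus hω
      have hd := dotProduct_le_dotProduct_of_stronglyDominates (hdom n hn0) hx hy
      rw [hone x hx, hone y hy] at hxy hd
      rw [sum_mul_dev, sum_mul_dev, ← sqrt_mul_radius hp, ← mul_sub, mul_left_comm]
      refine mul_lt_mul_of_pos_left ?_ hp'
      linarith
    · conv_rhs => rw [← exp_neg_log_one_div hδ0]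
      exact Real.exp_le_exp.2 (neg_le_neg (log_one_div_le_logCost 1 δ))
  · have h := measure_exists_level_le (measurable_dev hmeas hp) hind hsubG (Real.log (1 / δ))
    rw [exp_neg_log_one_div hδ0] at h
    refine (measure_mono fun ω hω => ?_).trans h
    simp only [Set.mem_ofPred_eq] at hω ⊢
    obtain ⟨n, hn, hlt⟩ := hω
    have hn0 := Finset.ne_of_mem_erase hn
    obtain ⟨c, h1, h2⟩ := exists_level_of_indexMinus_lt_indexPlus hlt
    -- By strong dominance the smallest mean of category `0` lies above all means of category n and
    -- below those of `0`. Recentring the level there only enlarges both truncated sums.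
    obtain ⟨k0, hk0⟩ := Finite.exists_min (μ 0)
    have hscale : ∀ u z : Fin K → ℝ, (∀ k, √p * u k ≤ z k) →
        radius K p δ ^ 2 < ∑ k, max (u k) 0 ^ 2 →
        2 * (K * Real.log 2 + Real.log (1 / δ)) < ∑ k, max (z k) 0 ^ 2 := by
      intro u z huz hu
      have h3 : (√p * radius K p δ) ^ 2 = 2 * (K * Real.log 2 + Real.log (1 / δ)) := by
        rw [sqrt_mul_radius hp, Real.sq_sqrt (by have := logCost_pos K hδ0 hδ1; positivity), logCost]
      rw [← h3, mul_pow]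
      calc _ < √p ^ 2 * ∑ k, max (u k) 0 ^ 2 := mul_lt_mul_of_pos_left hu (by positivity)
        _ ≤ _ := by
          rw [Finset.mul_sum]
          refine Finset.sum_le_sum fun k _ => ?_
          rw [← mul_pow, mul_max_of_nonneg _ _ hp'.le, mul_zero]
          have := huz k
          gcongr
    refine ⟨n, hn, √p * (c - μ 0 k0), hscale _ _ (fun k => ?_) h1, hscale _ _ (fun k => ?_) h2⟩
    · rw [dev, roundVec, ← mul_sub]
      have := hdom n hn0 k0 k
      refine mul_le_mul_of_nonneg_left ?_ hp'.le
      dsimp only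
      linarith
    · rw [dev, roundVec, ← mul_sub]
      have := hk0 k
      refine mul_le_mul_of_nonneg_left ?_ hp'.le
      dsimp only
      linarith

/-- The confidence bounds of the arms of the best category hold with high probability. -/
theorem measure_confidence_fails_le [NeZero K]
    (hindep : iIndepFun (fun i : Fin M × Fin K × ℕ => X i.1 i.2.1 i.2.2) P)
    (hsub : ∀ m k r, HasSubgaussianMGF (fun ω => X m k r ω - μ m k) 1 P)
    (hδ0 : 0 < δ) (hδ1 : δ < 1) (hp : 0 < p) :
    P {ω | ∃ k ∈ (Finset.univ : Finset (Fin K)),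
        if k = 0 then ucbIndex (fun r => X 0 k r ω) p δ < μ 0 k
        else μ 0 k < empMean (fun r => X 0 k r ω) p - √(2 * Real.log (1 / δ) / p)} ≤
      (K : ℝ≥0∞) * ENNReal.ofReal δ := by
  have hp1 : (0 : ℝ) < p := by exact_mod_cast hp
  have hp' : (0 : ℝ) < √p := Real.sqrt_pos.2 hp1
  have hL := log_one_div_pos hδ0 hδ1
  have hsq : √p * √(2 * Real.log (1 / δ) / p) = √(2 * Real.log (1 / δ)) := by
    rw [← Real.sqrt_mul hp1.le, mul_div_cancel₀ _ hp1.ne']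
  have htail : ∀ Z : Ω → ℝ, HasSubgaussianMGF Z 1 P →
      P {ω | √(2 * Real.log (1 / δ)) < Z ω} ≤ ENNReal.ofReal δ := by
    intro Z hZ
    have h := hZ.measure_ge_le (ε := √(2 * Real.log (1 / δ))) (Real.sqrt_nonneg _)
    rw [Real.sq_sqrt (by positivity), NNReal.coe_one, mul_one, neg_div,
      mul_div_cancel_left₀ _ two_ne_zero, exp_neg_log_one_div hδ0, measureReal_def] at h
    refine (measure_mono fun ω hω => ?_).trans
      ((ENNReal.le_ofReal_iff_toReal_le (measure_ne_top P _) hδ0.le).2 h)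
    simp only [Set.mem_ofPred_eq] at hω ⊢
    exact hω.le
  refine (measure_exists_mem_le _ _ (c := ENNReal.ofReal δ) fun k _ => ?_).trans (by simp)
  -- Only one side per arm is needed: the best arm must not be underestimated, the others must not
  -- be overestimated. This costs K events instead of 2K.
  have hdev := hasSubgaussianMGF_dev hindep hsub hp (0, k)
  split_ifs with hk
  · refine (measure_mono fun ω hω => ?_).trans (htail _ hdev.neg)
    simp only [Set.mem_ofPred_eq, Pi.neg_apply, dev, ucbIndex, ← hsq, ← mul_neg] at hω ⊢
    exact mul_lt_mul_of_pos_left (by linarith) hp'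
  · refine (measure_mono fun ω hω => ?_).trans (htail _ hdev)
    simp only [Set.mem_ofPred_eq, dev, ← hsq] at hω ⊢
    exact mul_lt_mul_of_pos_left (by linarith) hp'

end

/-! ### Deterministic analysis on good rewards. -/

/-- The rewards for which the regret bound holds, when `N` rounds suffice to separate the other
categories from the best one. -/
structure GoodRewards {M K : ℕ} [NeZero M] [NeZero K] (μ : Fin M → Fin K → ℝ)
    (x : Fin M → Fin K → ℕ → ℝ) (δ : ℝ) (N T : ℕ) : Prop where
  keep : ∀ p, 0 < p → p ≤ T → ∀ n, n ≠ 0 →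
    indexPlus (roundVec x p n) p δ ≤ indexMinus (roundVec x p 0) p δ
  drop : ∀ p, N ≤ p → p ≤ T → ∀ m, m ≠ 0 →
    indexMinus (roundVec x p m) p δ < indexPlus (roundVec x p 0) p δ
  best : ∀ p, 0 < p → p ≤ T → μ 0 0 ≤ ucbIndex (x 0 0) p δ
  others : ∀ p, 0 < p → p ≤ T → ∀ k, k ≠ 0 →
    empMean (x 0 k) p - √(2 * Real.log (1 / δ) / p) ≤ μ 0 k

section

variable {M K : ℕ} [NeZero K] (x : Fin M → Fin K → ℕ → ℝ) (δ : ℝ)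

theorem step_pulls (s : State M K) (a : Fin M × Fin K) (m : Fin M) (k : Fin K) :
    (step x δ s a).pulls m k = if (m, k) = a then s.pulls m k + 1 else s.pulls m k := by
  simp only [step]
  split_ifs <;> simp [*]

theorem stateAt_pulls_le (act : ℕ → Fin M × Fin K) (t : ℕ) (m : Fin M) (k : Fin K) :
    (stateAt x δ act t).pulls m k ≤ t := by
  induction t with
  | zero => exact le_rfl
  | succ t ih =>
    rw [stateAt, step_pulls]
    split_ifs <;> omega

theorem regret_eq_sum_pulls [NeZero M] (μ : Fin M → Fin K → ℝ) (act : ℕ → Fin M × Fin K) (T : ℕ) :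
    regret μ T act = ∑ m, ∑ k, gap μ m k * (stateAt x δ act T).pulls m k := by
  induction T with
  | zero => simp [regret, stateAt, initState]
  | succ T ih =>
    rw [regret, Finset.sum_range_succ, ← regret, ih]
    have h : ∀ m k, gap μ m k * ((stateAt x δ act (T + 1)).pulls m k : ℝ) =
        gap μ m k * (stateAt x δ act T).pulls m k +
          if (m, k) = act T then gap μ m k else 0 := by
      intro m k
      rw [stateAt, step_pulls]
      split_ifs
      · push_cast; ring
      · ring
    simp only [h, Finset.sum_add_distrib]
    congr 1
    rw [← Fintype.sum_prod_type' (f := fun m k => if (m, k) = act T then gap μ m k else 0)]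
    simp

end

theorem mem_passing_iff {M K : ℕ} [NeZero K] {x : Fin M → Fin K → ℕ → ℝ} {δ : ℝ}
    {pulls : Fin M → Fin K → ℕ} {A : Finset (Fin M)} {p : ℕ}
    (hpulls : ∀ m ∈ A, ∀ k, pulls m k = p) (m : Fin M) :
    m ∈ passing x δ pulls A ↔ m ∈ A ∧ ∀ n ∈ A, n ≠ m →
      indexPlus (roundVec x p n) p δ ≤ indexMinus (roundVec x p m) p δ := by
  have hvec : ∀ n ∈ A, empVec x pulls n = roundVec x p n := by
    intro n hn
    funext k
    rw [empVec, roundVec, hpulls n hn]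
  rw [passing, Finset.mem_filter]
  refine and_congr_right fun hm => forall₂_congr fun n hn => ?_
  rw [hvec n hn, hvec m hm, hpulls n hn, hpulls m hm]

section

variable {M K : ℕ} [NeZero M] [NeZero K]

/-- The elimination phase during round `p + 1`. -/
def Eliminating (N : ℕ) (s : State M K) : Prop :=
  ∃ p < N, 0 ∈ s.active ∧ s.pending.Nonempty ∧ s.pending ⊆ s.active ×ˢ Finset.univ ∧
    (∀ m k, s.pulls m k ≤ p + 1) ∧
    ∀ m ∈ s.active, ∀ k, s.pulls m k = if (m, k) ∈ s.pending then p else p + 1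

/-- The UCB phase on the best category, with the bounds on the numbers of pulls. -/
def Exploiting (μ : Fin M → Fin K → ℝ) (δ : ℝ) (N : ℕ) (s : State M K) : Prop :=
  s.active = {0} ∧ s.pending = ∅ ∧ (∀ k, 0 < s.pulls 0 k) ∧
    (∀ m, m ≠ 0 → ∀ k, s.pulls m k ≤ N) ∧
    ∀ k, s.pulls 0 k ≤ N ∨ ((s.pulls 0 k : ℝ) - 1) * gap μ 0 k ^ 2 ≤ 8 * Real.log (1 / δ)

variable {μ : Fin M → Fin K → ℝ} {x : Fin M → Fin K → ℕ → ℝ} {δ : ℝ} {N T : ℕ}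

/-- Category `0` passes every test, so the reset to all categories never happens, and a sole
survivor must be `0`. -/
theorem Eliminating.step (hG : GoodRewards μ x δ N T) {s : State M K} {a : Fin M × Fin K}
    (hs : Eliminating N s) (ha : Allowed x δ s a)
    (hT : ∀ m k, (step x δ s a).pulls m k ≤ T) :
    Eliminating N (step x δ s a) ∨ Exploiting μ δ N (step x δ s a) := by
  obtain ⟨p, hpN, h0, hne, hsub, hle, hpulls⟩ := hs
  have hne' : s.pending ≠ ∅ := hne.ne_empty
  rw [Allowed, if_neg hne'] at ha
  have ha1 : a.1 ∈ s.active := (Finset.mem_product.1 (hsub ha)).1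
  have hle' : ∀ m k, (CategorizedBandit.step x δ s a).pulls m k ≤ p + 1 := by
    intro m k
    rw [step_pulls]
    split_ifs with h
    · subst h
      rw [hpulls m ha1, if_pos ha]
    · exact hle m k
  have hpulls' : ∀ m ∈ s.active, ∀ k, (CategorizedBandit.step x δ s a).pulls m k =
      if (m, k) ∈ s.pending.erase a then p else p + 1 := by
    intro m hm k
    rw [step_pulls, hpulls m hm]
    simp only [Finset.mem_erase]
    by_cases h : (m, k) = a
    · simp [h, ha]
    · simp [h]
  by_cases her : s.pending.erase a = ∅
  · set pulls' := (CategorizedBandit.step x δ s a).pulls with hdef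
    have hall : ∀ m ∈ s.active, ∀ k, pulls' m k = p + 1 := by
      intro m hm k
      rw [hpulls' m hm, her]
      simp
    have hpT : p + 1 ≤ T := hall 0 h0 0 ▸ hT 0 0
    have hmem := mem_passing_iff (x := x) (δ := δ) hall
    have h0p : 0 ∈ passing x δ pulls' s.active :=
      (hmem 0).2 ⟨h0, fun n _ hn => hG.keep _ p.succ_pos hpT n hn⟩
    have hsurv : survivors x δ pulls' s.active = passing x δ pulls' s.active := by
      rw [survivors, if_neg (Finset.ne_empty_of_mem h0p)]
    have hstep : CategorizedBandit.step x δ s a =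
        { pulls := pulls', active := passing x δ pulls' s.active,
          pending := if (passing x δ pulls' s.active).card = 1 then ∅
            else passing x δ pulls' s.active ×ˢ Finset.univ } := by
      have hp' : pulls' = fun m k => if (m, k) = a then s.pulls m k + 1 else s.pulls m k := by
        funext m k
        exact step_pulls x δ s a m k
      rw [← hsurv, hp']
      simp only [CategorizedBandit.step, if_neg hne', if_pos her]
    have hpa : ∀ m ∈ passing x δ pulls' s.active, m ∈ s.active := fun m hm => ((hmem m).1 hm).1
    by_cases hc : (passing x δ pulls' s.active).card = 1
    · right
      obtain ⟨b, hb⟩ := Finset.card_eq_one.1 hc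
      have hb0 : passing x δ pulls' s.active = {0} := by
        rw [hb] at h0p ⊢
        rw [Finset.mem_singleton.1 h0p]
      rw [hstep, if_pos hc]
      refine ⟨hb0, rfl, fun k => ?_, fun m _ k => ?_, fun k => Or.inl ?_⟩
      · simp only [hall 0 h0]
        exact p.succ_pos
      · exact (hle' m k).trans hpN
      · exact (hle' 0 k).trans hpN
    · left
      -- After N completed rounds, category `0`, still active, would have removed all others.
      have hpN' : p + 1 < N := by
        by_contra hge
        refine hc (Finset.card_eq_one.2 ⟨0, Finset.eq_singleton_iff_unique_mem.2 ⟨h0p, ?_⟩⟩)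
        intro m hm
        by_contra hm0
        exact absurd (((hmem m).1 hm).2 0 h0 (Ne.symm hm0))
          (not_le.2 (hG.drop _ (not_lt.1 hge) hpT m hm0))
      rw [hstep, if_neg hc]
      refine ⟨p + 1, hpN', h0p, ⟨(0, 0), ?_⟩, subset_rfl, fun m k => ?_, fun m hm k => ?_⟩
      · simpa using h0p
      · exact (hle' m k).trans (by omega)
      · have hm' : (m, k) ∈ passing x δ pulls' s.active ×ˢ (Finset.univ : Finset (Fin K)) := by
          simpa using hm
        simp only [if_pos hm']
        exact hall m (hpa m hm) k
  · left
    have hact : (CategorizedBandit.step x δ s a).active = s.active := by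
      simp only [CategorizedBandit.step, if_neg hne', if_neg her]
    have hpend : (CategorizedBandit.step x δ s a).pending = s.pending.erase a := by
      simp only [CategorizedBandit.step, if_neg hne', if_neg her]
    refine ⟨p, hpN, hact ▸ h0, hpend ▸ Finset.nonempty_iff_ne_empty.2 her, ?_, hle', ?_⟩
    · rw [hact, hpend]
      exact (Finset.erase_subset _ _).trans hsub
    · rw [hact, hpend]
      exact hpulls'

/-- The usual UCB argument: a chosen arm has an index at least that of the best arm, hence at least
`μ 0 0`, so its gap is at most twice its confidence width. -/
theorem Exploiting.step (hbest : ∀ k, μ 0 k ≤ μ 0 0) (hδ : 0 ≤ Real.log (1 / δ))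
    (hG : GoodRewards μ x δ N T) {s : State M K} {a : Fin M × Fin K}
    (hs : Exploiting μ δ N s) (ha : Allowed x δ s a) (hT : ∀ m k, s.pulls m k ≤ T) :
    Exploiting μ δ N (step x δ s a) := by
  obtain ⟨hact, hpend, hpos, hoth, hbd⟩ := hs
  rw [Allowed, if_pos hpend, hact, Finset.mem_singleton] at ha
  obtain ⟨ha0, hmax⟩ := ha
  obtain ⟨m0, k0⟩ := a
  simp only at ha0
  subst ha0
  simp only at hmax
  refine ⟨?_, ?_, fun k => ?_, fun m hm k => ?_, fun k => ?_⟩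
  · simp only [CategorizedBandit.step, if_pos hpend, hact]
  · simp only [CategorizedBandit.step, if_pos hpend]
  · rw [step_pulls]
    split_ifs
    · exact Nat.succ_pos _
    · exact hpos k
  · rw [step_pulls, if_neg fun h => hm (Prod.mk.inj h).1]
    exact hoth m hm k
  · rw [step_pulls]
    split_ifs with hk
    · right
      obtain rfl : k = k0 := (Prod.mk.inj hk).2
      push_cast
      -- The new count minus one is the count at the moment of choice, to which the confidence
      -- bounds apply.
      rw [add_sub_cancel_right]
      by_cases hk0 : k = 0
      · subst hk0
        simp only [gap, sub_self]
        simpa only [zero_pow two_ne_zero, mul_zero] using mul_nonneg (by norm_num) hδ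
      have hn : (0 : ℝ) < s.pulls 0 k := by exact_mod_cast hpos k
      have h1 := hG.best _ (hpos 0) (hT 0 0)
      have h2 := hG.others _ (hpos k) (hT 0 k) k hk0
      have h3 := hmax 0
      rw [ucbIndex.eq_def (x 0 k)] at h3
      have h4 : gap μ 0 k ≤ 2 * √(2 * Real.log (1 / δ) / s.pulls 0 k) := by
        rw [gap]
        linarith
      have h5 : 0 ≤ gap μ 0 k := sub_nonneg.2 (hbest k)
      have h6 : gap μ 0 k ^ 2 ≤ 4 * (2 * Real.log (1 / δ) / s.pulls 0 k) := by
        calc gap μ 0 k ^ 2 ≤ (2 * √(2 * Real.log (1 / δ) / s.pulls 0 k)) ^ 2 := by gcongr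
          _ = _ := by rw [mul_pow, Real.sq_sqrt (by positivity)]; norm_num
      calc (s.pulls 0 k : ℝ) * gap μ 0 k ^ 2
          ≤ s.pulls 0 k * (4 * (2 * Real.log (1 / δ) / s.pulls 0 k)) := by gcongr
        _ = 8 * Real.log (1 / δ) := by
          rw [mul_left_comm, mul_div_cancel₀ _ hn.ne', ← mul_assoc]
          norm_num
    · exact hbd k

theorem eliminating_or_exploiting (hbest : ∀ k, μ 0 k ≤ μ 0 0) (hδ : 0 ≤ Real.log (1 / δ))
    (hN : 0 < N) (hG : GoodRewards μ x δ N T) {act : ℕ → Fin M × Fin K}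
    (hrun : IsCatSERun x δ T act) {t : ℕ} (ht : t ≤ T) :
    Eliminating N (stateAt x δ act t) ∨ Exploiting μ δ N (stateAt x δ act t) := by
  induction t with
  | zero =>
    left
    refine ⟨0, hN, Finset.mem_univ _, Finset.univ_nonempty, ?_, fun _ _ => Nat.zero_le _, ?_⟩
    · intro i _
      simp [stateAt, initState]
    · intro m _ k
      simp [stateAt, initState]
  | succ t ih =>
    rcases ih (by omega) with h | h
    · exact h.step hG (hrun t ht) fun m k => (stateAt_pulls_le x δ act (t + 1) m k).trans ht
    · exact Or.inr (h.step hbest hδ hG (hrun t ht) fun m k =>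
        (stateAt_pulls_le x δ act t m k).trans (by omega))

theorem gap_nonneg (hbest : ∀ k, μ 0 k ≤ μ 0 0)
    (hdom : ∀ m, m ≠ 0 → StronglyDominates (μ 0) (μ m)) (m : Fin M) (k : Fin K) :
    0 ≤ gap μ m k := by
  by_cases hm : m = 0
  · subst hm
    exact sub_nonneg.2 (hbest k)
  · exact sub_nonneg.2 (hdom m hm 0 k)

/-- The regret bound for good rewards. -/
theorem regret_le_of_goodRewards (hbest : ∀ k, μ 0 k ≤ μ 0 0)
    (hdom : ∀ m, m ≠ 0 → StronglyDominates (μ 0) (μ m)) (hδ : 0 ≤ Real.log (1 / δ))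
    (hN : 0 < N) (hG : GoodRewards μ x δ N T) {act : ℕ → Fin M × Fin K}
    (hrun : IsCatSERun x δ T act) :
    regret μ T act ≤ ∑ k with 0 < gap μ 0 k, 8 * Real.log (1 / δ) / gap μ 0 k +
      N * ∑ m, ∑ k, gap μ m k := by
  have hgap := gap_nonneg hbest hdom
  have key : ∀ m k, gap μ m k * (stateAt x δ act T).pulls m k ≤
      (if m = 0 then if 0 < gap μ 0 k then 8 * Real.log (1 / δ) / gap μ 0 k else 0 else 0) +
        N * gap μ m k := by
    intro m k
    have hextra : 0 ≤ (if m = 0 then if 0 < gap μ 0 k then 8 * Real.log (1 / δ) / gap μ 0 k else 0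
        else 0) := by
      split_ifs <;> positivity
    have hsmall : (stateAt x δ act T).pulls m k ≤ N → gap μ m k * (stateAt x δ act T).pulls m k ≤
      (if m = 0 then if 0 < gap μ 0 k then 8 * Real.log (1 / δ) / gap μ 0 k else 0 else 0) +
        N * gap μ m k := by
      intro h
      have : ((stateAt x δ act T).pulls m k : ℝ) ≤ N := by exact_mod_cast h
      nlinarith [mul_le_mul_of_nonneg_left this (hgap m k)]
    rcases eliminating_or_exploiting hbest hδ hN hG hrun le_rfl with
      ⟨p, hp, -, -, -, hle, -⟩ | ⟨-, -, -, hoth, hbd⟩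
    · exact hsmall ((hle m k).trans hp)
    · by_cases hm : m = 0
      · subst hm
        rcases hbd k with h | h
        · exact hsmall h
        · rw [if_pos rfl]
          split_ifs with hpos
          · have h1 : ((stateAt x δ act T).pulls 0 k - 1 : ℝ) * gap μ 0 k ≤
                8 * Real.log (1 / δ) / gap μ 0 k := by
              rw [le_div_iff₀ hpos]
              linarith
            -- The one pull beyond the UCB bound is absorbed by the term with N.
            have h2 : (1 : ℝ) ≤ N := by exact_mod_cast hN
            nlinarith [mul_le_mul_of_nonneg_right h2 hpos.le]
          · rw [le_antisymm (not_lt.1 hpos) (hgap 0 k)]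
            simp
      · exact hsmall (hoth m hm k)
  rw [regret_eq_sum_pulls x δ]
  refine (Finset.sum_le_sum fun m _ => Finset.sum_le_sum fun k _ => key m k).trans (le_of_eq ?_)
  simp only [Finset.sum_add_distrib, ← Finset.mul_sum]
  congr 1
  rw [Finset.sum_filter, Finset.sum_eq_single 0]
  · simp
  · intro m _ hm
    simp [hm]
  · simp

end

/-! ### From the separation cost to a number of rounds. -/

theorem exists_separating_pair {K : ℕ} {u v : Fin K → ℝ} {c : ℝ} (hc : 0 < c)
    (h : separationCost u v < ENNReal.ofReal c) :
    ∃ x ∈ stdSimplex ℝ (Fin K), ∃ y ∈ stdSimplex ℝ (Fin K),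
      0 < x ⬝ᵥ u - y ⬝ᵥ v ∧ (norm2 x + norm2 y) ^ 2 < c * (x ⬝ᵥ u - y ⬝ᵥ v) ^ 2 := by
  simp only [separationCost, iInf_lt_iff] at h
  obtain ⟨x, hx, y, hy, hlt⟩ := h
  have hpos : 0 < norm2 x + norm2 y := add_pos (norm2_pos hx) (norm2_pos hy)
  have hg : 0 < x ⬝ᵥ u - y ⬝ᵥ v := by
    by_contra hg
    rw [ENNReal.ofReal_of_nonpos (not_lt.1 hg),
      ENNReal.div_zero (ENNReal.ofReal_pos.2 hpos).ne', ENNReal.top_pow two_ne_zero] at hlt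
    exact not_top_lt hlt
  refine ⟨x, hx, y, hy, hg, ?_⟩
  rw [← ENNReal.ofReal_div_of_pos hg, ← ENNReal.ofReal_pow (by positivity),
    ENNReal.ofReal_lt_ofReal_iff hc, div_pow, div_lt_iff₀ (by positivity)] at hlt
  exact hlt

theorem separationCost_anti {K : ℕ} {u v w : Fin K → ℝ} (h : StronglyDominates v w) :
    separationCost u w ≤ separationCost u v := by
  refine iInf₂_mono fun x _ => iInf₂_mono fun y hy => ?_
  have := dotProduct_le_dotProduct_of_stronglyDominates h hy hy
  gcongr

/-- One radius covers the penalty in the indices, the other the fluctuation. As β² = 2 `logCost`/p,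
the square of 2β gives the constant 8. -/
theorem two_mul_radius_mul_lt {K N p : ℕ} {δ s g : ℝ} (ha : 0 < logCost K δ)
    (hg : 0 < g) (hN : 0 < N) (hNp : N ≤ p) (h : s ^ 2 < N / (8 * logCost K δ) * g ^ 2) :
    2 * radius K p δ * s < g := by
  have hp : (0 : ℝ) < p := by exact_mod_cast hN.trans_le hNp
  have hNp' : (N : ℝ) ≤ p := by exact_mod_cast hNp
  have hr : radius K p δ ^ 2 = 2 / p * logCost K δ := by
    rw [radius, ← logCost, Real.sq_sqrt (by positivity)]
  refine lt_of_pow_lt_pow_left₀ 2 hg.le ?_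
  calc (2 * radius K p δ * s) ^ 2 = 8 * logCost K δ / p * s ^ 2 := by
        rw [mul_pow, mul_pow, hr]; ring
    _ < 8 * logCost K δ / p * (N / (8 * logCost K δ) * g ^ 2) :=
        mul_lt_mul_of_pos_left h (by positivity)
    _ = N / p * g ^ 2 := by field_simp
    _ ≤ 1 * g ^ 2 := by
        gcongr
        exact (div_le_one hp).2 hNp'
    _ = g ^ 2 := one_mul _

/-! ### Assembling the probability and regret bounds. -/

section

variable {M K : ℕ} [NeZero M] [NeZero K] {Ω : Type*} [MeasurableSpace Ω] {P : Measure Ω}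
  [IsProbabilityMeasure P] {μ : Fin M → Fin K → ℝ} {X : Fin M → Fin K → ℕ → Ω → ℝ} {δ : ℝ}

theorem measure_not_goodRewards_le (hmeas : ∀ m k r, Measurable (X m k r))
    (hindep : iIndepFun (fun i : Fin M × Fin K × ℕ => X i.1 i.2.1 i.2.2) P)
    (hsub : ∀ m k r, HasSubgaussianMGF (fun ω => X m k r ω - μ m k) 1 P)
    (hdom : ∀ m, m ≠ 0 → StronglyDominates (μ 0) (μ m))
    (hδ0 : 0 < δ) (hδ1 : δ < 1) {N : ℕ} (hN : 0 < N)
    (hsep : ∀ m, m ≠ 0 → separationCost (μ 0) (μ m) < ENNReal.ofReal (N / (8 * logCost K δ)))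
    (T : ℕ) :
    P {ω | ¬ GoodRewards μ (fun m k r => X m k r ω) δ N T} ≤
      ENNReal.ofReal (2 * δ * M * K * T) := by
  have ha := logCost_pos K hδ0 hδ1
  have hround : ∀ p ∈ Finset.Icc 1 T, P {ω |
      ((∃ n ∈ Finset.univ.erase (0 : Fin M),
        indexMinus (roundVec (fun m k r => X m k r ω) p 0) p δ <
          indexPlus (roundVec (fun m k r => X m k r ω) p n) p δ) ∨
      ∃ m ∈ Finset.univ.erase (0 : Fin M), N ≤ p ∧
        indexPlus (roundVec (fun m k r => X m k r ω) p 0) p δ ≤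
          indexMinus (roundVec (fun m k r => X m k r ω) p m) p δ) ∨
      ∃ k ∈ (Finset.univ : Finset (Fin K)),
        if k = 0 then ucbIndex (fun r => X 0 k r ω) p δ < μ 0 k
        else μ 0 k < empMean (fun r => X 0 k r ω) p - √(2 * Real.log (1 / δ) / p)} ≤
      ((2 * M * K : ℕ) : ℝ≥0∞) * ENNReal.ofReal δ := by
    intro p hp
    have hp0 : 0 < p := (Finset.mem_Icc.1 hp).1
    have h2 : ∀ m ∈ Finset.univ.erase (0 : Fin M), P {ω | N ≤ p ∧
        indexPlus (roundVec (fun m k r => X m k r ω) p 0) p δ ≤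
          indexMinus (roundVec (fun m k r => X m k r ω) p m) p δ} ≤ ENNReal.ofReal δ := by
      intro m hm
      have hm0 := Finset.ne_of_mem_erase hm
      by_cases hNp : N ≤ p
      · obtain ⟨x, hx, y, hy, hg, hlt⟩ := exists_separating_pair (by positivity) (hsep m hm0)
        simp only [hNp, true_and]
        exact measure_not_separated_le hmeas hindep hsub hδ0 hδ1 hp0 hm0 hx hy
          (two_mul_radius_mul_lt ha hg hN hNp hlt)
      · simp [hNp]
    refine (measure_or_le (measure_or_le
      (measure_best_eliminated_le hmeas hindep hsub hdom hδ0 hδ1 hp0)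
      (measure_exists_mem_le _ _ h2))
      (measure_confidence_fails_le hindep hsub hδ0 hδ1 hp0)).trans ?_
    rw [← add_mul, ← add_mul]
    gcongr
    rw [Finset.card_erase_of_mem (Finset.mem_univ _), Finset.card_univ, Fintype.card_fin]
    norm_cast
    have hM : 0 < M := NeZero.pos M
    have hK : 0 < K := NeZero.pos K
    obtain ⟨M', rfl⟩ : ∃ M', M = M' + 1 := ⟨M - 1, by omega⟩
    -- The count is 2(M-1) + 1 for K = 1 and M + 3(M-1) + K for K ≥ 2; both are at most 2MK.
    split_ifs with hK1
    · subst hK1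
      omega
    · obtain ⟨K', rfl⟩ : ∃ K', K = K' + 2 := ⟨K - 2, by omega⟩
      rw [Nat.add_sub_cancel]
      nlinarith [Nat.zero_le (M' * K')]
  refine (measure_mono fun ω hω => ?_).trans
    ((measure_exists_mem_le _ _ hround).trans (le_of_eq ?_))
  · simp only [Set.mem_ofPred_eq] at hω ⊢
    by_contra hcon
    push Not at hcon
    refine hω ⟨fun p hp0 hpT n hn => ?_, fun p hNp hpT m hm => ?_, fun p hp0 hpT => ?_,
      fun p hp0 hpT k hk => ?_⟩
    · exact (hcon p (Finset.mem_Icc.2 ⟨hp0, hpT⟩)).1.1 n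
        (Finset.mem_erase.2 ⟨hn, Finset.mem_univ n⟩)
    · exact (hcon p (Finset.mem_Icc.2 ⟨hN.trans_le hNp, hpT⟩)).1.2 m
        (Finset.mem_erase.2 ⟨hm, Finset.mem_univ m⟩) hNp
    · have h := (hcon p (Finset.mem_Icc.2 ⟨hp0, hpT⟩)).2 0 (Finset.mem_univ 0)
      rw [if_pos rfl] at h
      exact not_lt.1 h
    · have h := (hcon p (Finset.mem_Icc.2 ⟨hp0, hpT⟩)).2 k (Finset.mem_univ k)
      rw [if_neg hk] at h
      exact not_lt.1 h
  · rw [Nat.card_Icc, Nat.add_sub_cancel, ← mul_assoc, ← Nat.cast_mul, ← ENNReal.ofReal_natCast,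
      ← ENNReal.ofReal_mul (by positivity)]
    congr 1
    push_cast
    ring

/-- The complement of a measurable hull of an unlikely set. -/
theorem exists_measurableSet_of_measure_compl_le {p : Ω → Prop} {ε : ℝ} (hε : 0 ≤ ε)
    (h : P {ω | ¬ p ω} ≤ ENNReal.ofReal ε) :
    ∃ E : Set Ω, MeasurableSet E ∧ 1 - ε ≤ P.real E ∧ ∀ ω ∈ E, p ω := by
  refine ⟨(toMeasurable P {ω | ¬ p ω})ᶜ, (measurableSet_toMeasurable _ _).compl, ?_, ?_⟩
  · rw [probReal_compl_eq_one_sub (measurableSet_toMeasurable _ _), measureReal_def,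
      measure_toMeasurable]
    exact sub_le_sub_left (ENNReal.toReal_le_of_le_ofReal hε h) 1
  · intro ω hω
    by_contra hp
    exact hω (subset_toMeasurable P _ hp)

theorem regretBound_mono (μ : Fin M → Fin K → ℝ) (δ : ℝ) {D D' : ℝ≥0∞} (h : D ≤ D') :
    regretBound μ δ D ≤ regretBound μ δ D' := by
  unfold regretBound
  gcongr

/-- Either some gap is positive and the bound is infinite, or all gaps vanish and so does the
regret; this covers 0 · ∞ = 0. -/
theorem ofReal_regret_le_regretBound_top (hbest : ∀ k, μ 0 k ≤ μ 0 0)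
    (hdom : ∀ m, m ≠ 0 → StronglyDominates (μ 0) (μ m)) (hδ0 : 0 < δ) (hδ1 : δ < 1)
    (T : ℕ) (act : ℕ → Fin M × Fin K) :
    ENNReal.ofReal (regret μ T act) ≤ regretBound μ δ ⊤ := by
  have hgap := gap_nonneg hbest hdom
  have ha : 0 < 8 * (K * Real.log 2 + Real.log (1 / δ)) := by
    have := logCost_pos K hδ0 hδ1
    rw [logCost] at this
    positivity
  rcases (Finset.sum_nonneg fun m _ => Finset.sum_nonneg fun k _ => hgap m k :
    0 ≤ ∑ m, ∑ k, gap μ m k).eq_or_lt with h | h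
  · have h0 : ∀ m k, gap μ m k = 0 := by
      intro m k
      have h1 := (Finset.sum_eq_zero_iff_of_nonneg fun m _ =>
        Finset.sum_nonneg fun k _ => hgap m k).1 h.symm m (Finset.mem_univ m)
      exact (Finset.sum_eq_zero_iff_of_nonneg fun k _ => hgap m k).1 h1 k (Finset.mem_univ k)
    simp [regret, h0]
  · rw [regretBound, ENNReal.mul_top (ENNReal.ofReal_pos.2 (mul_pos ha h)).ne', add_top]
    exact le_top

theorem ofReal_regret_le_regretBound (hbest : ∀ k, μ 0 k ≤ μ 0 0)
    (hdom : ∀ m, m ≠ 0 → StronglyDominates (μ 0) (μ m)) (hδ0 : 0 < δ) (hδ1 : δ < 1)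
    {D : ℝ} (hD : 0 ≤ D) {N T : ℕ} (hN : 0 < N) (hND : N ≤ 8 * logCost K δ * D + 1)
    {x : Fin M → Fin K → ℕ → ℝ} (hG : GoodRewards μ x δ N T) {act : ℕ → Fin M × Fin K}
    (hrun : IsCatSERun x δ T act) :
    ENNReal.ofReal (regret μ T act) ≤ regretBound μ δ (ENNReal.ofReal D) := by
  have hgap := gap_nonneg hbest hdom
  have hL := log_one_div_pos hδ0 hδ1
  have ha := logCost_pos K hδ0 hδ1
  have hS : 0 ≤ ∑ m, ∑ k, gap μ m k :=
    Finset.sum_nonneg fun m _ => Finset.sum_nonneg fun k _ => hgap m k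
  have hF : 0 ≤ ∑ k with 0 < gap μ 0 k, 8 * Real.log (1 / δ) / gap μ 0 k :=
    Finset.sum_nonneg fun k _ => div_nonneg (by positivity) (hgap 0 k)
  rw [regretBound, ← logCost, ← ENNReal.ofReal_mul (by positivity), ← ENNReal.ofReal_add hF hS,
    ← ENNReal.ofReal_add (by positivity) (by positivity)]
  refine ENNReal.ofReal_le_ofReal
    ((regret_le_of_goodRewards hbest hdom hL.le hN hG hrun).trans ?_)
  nlinarith [mul_le_mul_of_nonneg_right hND hS]

end

end CategorizedBandit

open CategorizedBandit in
theorem mainTheorem1 {M K : ℕ} [NeZero M] [NeZero K]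
    {Ω : Type*} [MeasurableSpace Ω] (P : Measure Ω) [IsProbabilityMeasure P]
    (μ : Fin M → Fin K → ℝ) (X : Fin M → Fin K → ℕ → Ω → ℝ)
    (hmeas : ∀ m k r, Measurable (X m k r))
    (hindep : iIndepFun (fun i : Fin M × Fin K × ℕ => X i.1 i.2.1 i.2.2) P)
    (hsub : ∀ m k r, HasSubgaussianMGF (fun ω => X m k r ω - μ m k) 1 P)
    (hbest : ∀ k, μ 0 k ≤ μ 0 0)
    (hdom : ∀ m, m ≠ 0 → StronglyDominates (μ 0) (μ m))
    (δ : ℝ) (hδ0 : 0 < δ) (hδ1 : δ < 1) (T : ℕ) :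
    ∃ E : Set Ω, MeasurableSet E ∧ 1 - 2 * δ * M * K * T ≤ P.real E ∧
      ∀ ω ∈ E, ∀ act : ℕ → Fin M × Fin K, IsCatSERun (fun m k r => X m k r ω) δ T act →
        ENNReal.ofReal (regret μ T act) ≤
            regretBound μ δ (⨆ (m : Fin M) (_ : m ≠ 0), separationCost (μ 0) (μ m)) ∧
        (2 ≤ M → (∀ m : Fin M, 2 ≤ (m : ℕ) → StronglyDominates (μ 1) (μ m)) →
          ENNReal.ofReal (regret μ T act) ≤
            regretBound μ δ (separationCost (μ 0) (μ 1))) := by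
  set D : ℝ≥0∞ := ⨆ (m : Fin M) (_ : m ≠ 0), separationCost (μ 0) (μ m) with hDdef
  suffices h : ∃ E : Set Ω, MeasurableSet E ∧ 1 - 2 * δ * M * K * T ≤ P.real E ∧
      ∀ ω ∈ E, ∀ act : ℕ → Fin M × Fin K, IsCatSERun (fun m k r => X m k r ω) δ T act →
        ENNReal.ofReal (regret μ T act) ≤ regretBound μ δ D by
    obtain ⟨E, hE, hPE, hreg⟩ := h
    refine ⟨E, hE, hPE, fun ω hω act hrun => ⟨hreg ω hω act hrun, fun hM h1 => ?_⟩⟩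
    -- Category `1` is then the hardest to separate from `0`, so its cost dominates the supremum.
    refine (hreg ω hω act hrun).trans (regretBound_mono μ δ (iSup₂_le fun m hm => ?_))
    rcases Nat.lt_or_ge m 2 with hm2 | hm2
    · have : m = 1 := by
        have hm0 : (m : ℕ) ≠ 0 := fun h => hm (Fin.ext (by simpa using h))
        refine Fin.ext ?_
        rw [Fin.val_one', Nat.mod_eq_of_lt hM]
        omega
      rw [this]
    · exact separationCost_anti (h1 m hm2)
  have hε : 0 ≤ 2 * δ * M * K * T := by positivity
  by_cases hD : D = ⊤
  · refine ⟨Set.univ, MeasurableSet.univ, ?_, fun ω _ act _ => ?_⟩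
    · rw [probReal_univ]
      linarith
    · rw [hD]
      exact ofReal_regret_le_regretBound_top hbest hdom hδ0 hδ1 T act
  · have ha := logCost_pos K hδ0 hδ1
    -- The floor plus one makes the inequality strict, so a near-optimal pair suffices; the extra
    -- round produces the middle term of the bound.
    set N : ℕ := ⌊8 * logCost K δ * D.toReal⌋₊ + 1 with hNdef
    have hlt : 8 * logCost K δ * D.toReal < N := by
      rw [hNdef]
      exact_mod_cast Nat.lt_floor_add_one _
    have hle : (N : ℝ) ≤ 8 * logCost K δ * D.toReal + 1 := by
      rw [hNdef, Nat.cast_add, Nat.cast_one]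
      gcongr
      exact Nat.floor_le (by positivity)
    have hsep : ∀ m, m ≠ 0 →
        separationCost (μ 0) (μ m) < ENNReal.ofReal (N / (8 * logCost K δ)) := by
      intro m hm
      refine (le_iSup₂ (f := fun (m : Fin M) (_ : m ≠ 0) => separationCost (μ 0) (μ m)) m
        hm).trans_lt ?_
      rw [← hDdef, ← ENNReal.ofReal_toReal hD, ENNReal.ofReal_lt_ofReal_iff (by positivity),
        lt_div_iff₀ (by positivity)]
      linarith
    obtain ⟨E, hE, hPE, hgood⟩ := exists_measurableSet_of_measure_compl_le hε
      (measure_not_goodRewards_le hmeas hindep hsub hdom hδ0 hδ1 (Nat.succ_pos _) hsep T)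
    refine ⟨E, hE, hPE, fun ω hω act hrun => ?_⟩
    rw [← ENNReal.ofReal_toReal hD]
    exact ofReal_regret_le_regretBound hbest hdom hδ0 hδ1 ENNReal.toReal_nonneg (Nat.succ_pos _)
      hle (hgood ω hω) hrun
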